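/- Let $S^1=\mathbb{R}/\mathbb{Z}$ and let $G=\mathrm{Diff}^{\omega,\delta}_+S^1$ be the group of orientation preserving real-analytic diffeomorphisms of $S^1$, regarded as a discrete group. Let $\widetilde G$ be the discrete group of all orientation preserving real-analytic diffeomorphisms $f$ of $\mathbb{R}$ with $f(x+1)=f(x)+1$ (the universal covering group), let $T(x)=x+1$, and let $0\to\mathbb{Z}\cdot T\to\widetilde G\xrightarrow{\,p\,}G\to 1$ be the resulting central extension. Let $\chi\in H^2(BG;\mathbb{Z})$ be its Euler class, and let $\mu:H_2(BG;\mathbb{Z})\to H_3(B\widetilde G;\mathbb{Z})$ be the map in the Gysin exact sequence of the associated circle bundle $B\widetilde G\to BG$ (it sends a cycle in the base to its preimage in the total space). For each integer $k\ge 2$ let $\varphi_k:\widetilde G\to\widetilde G$ be the endomorphism $\varphi_k(f)(x)=\frac1k f(kx)$. Suppose that for some $\sigma\in H_2(BG;\mathbb{Z})$ with $\chi(\sigma)\neq 0$ and some integer $k\ge 2$, $$(\varphi_k)_*(\mu(\sigma))=\mu(\sigma)\in H_3(B\widetilde G;\mathbb{Z}).$$ Then $\chi^2=\chi\cup\chi\neq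 0$ in $H^4(BG;\mathbb{Q})$. -/

import Mathlib

set_option linter.unusedSectionVars false

open scoped Topology
open CategoryTheory

noncomputable section
namespace FlatCircle

section Generic
variable {k : Type} [CommRing k] {ι : Type} {c : ComplexShape ι}
  (K : HomologicalComplex (ModuleCat.{0} k) c) (i j l : ι)

/-- The map sending an element of the kernel of `d : K_j → K_l` to its class in `H_j(K)`. -/
def classMap (hl : c.next j = l) : LinearMap.ker (K.d j l).hom →ₗ[k] K.homology j :=
  (K.homologyπ j).hom ∘ₗ (K.liftCycles
    (A := ModuleCat.of k (LinearMap.ker (K.d j l).hom))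
    (ModuleCat.ofHom (LinearMap.ker (K.d j l).hom).subtype) l hl (by ext x; exact x.2)).hom

lemma classMap_aux (hl : c.next j = l) (z : LinearMap.ker (K.d j l).hom) :
    (K.iCycles j).hom ((K.liftCycles
    (A := ModuleCat.of k (LinearMap.ker (K.d j l).hom))
    (ModuleCat.ofHom (LinearMap.ker (K.d j l).hom).subtype) l hl (by ext x; exact x.2)).hom z)
      = z.1 :=
  congrArg (fun φ : ModuleCat.of k (LinearMap.ker (K.d j l).hom) ⟶ K.X j => φ.hom z)
    (K.liftCycles_i _ l hl _)

lemma classMap_surjective (hl : c.next j = l) : Function.Surjective (classMap K j l hl) := by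
  intro σ
  obtain ⟨z, rfl⟩ := (ModuleCat.epi_iff_surjective (K.homologyπ j)).1 inferInstance σ
  have hz : (K.d j l).hom ((K.iCycles j).hom z) = 0 :=
    congrArg (fun φ : K.cycles j ⟶ K.X l => φ.hom z) (K.iCycles_d j l)
  refine ⟨⟨_, hz⟩, congrArg (K.homologyπ j).hom ?_⟩
  apply (ModuleCat.mono_iff_injective (K.iCycles j)).1 inferInstance
  exact classMap_aux K j l hl _

lemma classMap_eq_zero_iff (hi : c.prev j = i) (hl : c.next j = l)
    (z : LinearMap.ker (K.d j l).hom) :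
    classMap K j l hl z = 0 ↔ ∃ w, (K.d i j).hom w = z := by
  have hex : (ShortComplex.mk (K.toCycles i j) (K.homologyπ j)
      (K.toCycles_comp_homologyπ _ _)).Exact :=
    ShortComplex.exact_of_g_is_cokernel _ (K.homologyIsCokernel i j hi)
  rw [ShortComplex.moduleCat_exact_iff] at hex
  have hd : ∀ w, (K.iCycles j).hom ((K.toCycles i j).hom w) = (K.d i j).hom w := fun w =>
    congrArg (fun φ : K.X i ⟶ K.X j => φ.hom w) (K.toCycles_i i j)
  constructor
  · intro h
    obtain ⟨w, hw⟩ := hex _ h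
    exact ⟨w, (hd w).symm.trans ((congrArg _ hw).trans (classMap_aux K j l hl z))⟩
  · rintro ⟨w, hw⟩
    refine Eq.trans (congrArg (K.homologyπ j).hom ?_)
      (congrArg (fun φ : K.X i ⟶ K.homology j => φ.hom w) (K.toCycles_comp_homologyπ i j))
    apply (ModuleCat.mono_iff_injective (K.iCycles j)).1 inferInstance
    exact (classMap_aux K j l hl z).trans (hw.symm.trans (hd w).symm)

variable {A B C D M : Type} [AddCommGroup A] [Module k A] [AddCommGroup B] [Module k B]
  [AddCommGroup C] [Module k C] [AddCommGroup D] [Module k D] [AddCommGroup M] [Module k M]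

/-- Descent of a linear map along a surjective linear map. -/
def descend (q : A →ₗ[k] C) (hq : Function.Surjective q)
    (f : A →ₗ[k] M) (h : ∀ a, q a = 0 → f a = 0) : C →ₗ[k] M :=
  (LinearMap.ker q).liftQ f h ∘ₗ (q.quotKerEquivOfSurjective hq).symm.toLinearMap

lemma descend_apply (q : A →ₗ[k] C) (hq : Function.Surjective q)
    (f : A →ₗ[k] M) (h : ∀ a, q a = 0 → f a = 0) (a : A) :
    descend q hq f h (q a) = f a := by
  have : (q.quotKerEquivOfSurjective hq).symm (q a) = (LinearMap.ker q).mkQ a := by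
    rw [LinearEquiv.symm_apply_eq]; rfl
  rw [descend, LinearMap.comp_apply, LinearEquiv.coe_coe, this]; rfl

/-- Descent of a bilinear map along two surjective linear maps. -/
def descend₂ (q : A →ₗ[k] C) (hq : Function.Surjective q)
    (r : B →ₗ[k] D) (hr : Function.Surjective r) (f : A →ₗ[k] B →ₗ[k] M)
    (h : ∀ a, q a = 0 → ∀ b, f a b = 0) (h' : ∀ a b, r b = 0 → f a b = 0) :
    C →ₗ[k] D →ₗ[k] M :=
  (descend r hr (descend q hq f fun a ha => LinearMap.ext (h a ha)).flip fun b hb => by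
    ext c
    obtain ⟨a, rfl⟩ := hq c
    rw [LinearMap.flip_apply, descend_apply]
    exact h' a b hb).flip

lemma descend₂_apply (q : A →ₗ[k] C) (hq : Function.Surjective q)
    (r : B →ₗ[k] D) (hr : Function.Surjective r) (f : A →ₗ[k] B →ₗ[k] M)
    (h : ∀ a, q a = 0 → ∀ b, f a b = 0) (h' : ∀ a b, r b = 0 → f a b = 0) (a : A) (b : B) :
    descend₂ q hq r hr f h h' (q a) (r b) = f a b := by
  unfold descend₂
  rw [LinearMap.flip_apply, descend_apply, LinearMap.flip_apply, descend_apply]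

end Generic

section Homology
variable (k : Type) [CommRing k] (Γ : Type) [Group Γ]

/-- `H_n(BΓ; k)`: the homology of the classifying space of the discrete group `Γ` with constant
coefficients `k`, i.e. the group homology of `Γ` with trivial coefficients. -/
abbrev H (n : ℕ) : Type := groupHomology (Rep.trivial k Γ k) n

/-- `Hⁿ(BΓ; k)`: the group cohomology of `Γ` with trivial coefficients `k`. -/
abbrev Coh (n : ℕ) : Type := groupCohomology (Rep.trivial k Γ k) n

/-- Inhomogeneous `n`-chains; `Finsupp.single ![g₁, …, gₙ] 1` is the bar symbol `[g₁|…|gₙ]`. -/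
abbrev Chain (n : ℕ) : Type := (Fin n → Γ) →₀ k

/-- Inhomogeneous `n`-cochains. -/
abbrev Cochain (n : ℕ) : Type := (Fin n → Γ) → k

/-- The boundary map of the complex of inhomogeneous chains. -/
def bd (n : ℕ) : Chain k Γ (n+1) →ₗ[k] Chain k Γ n :=
  ((groupHomology.inhomogeneousChains (Rep.trivial k Γ k)).d (n+1) n).hom

/-- The coboundary map of the complex of inhomogeneous cochains. -/
def cobd (n : ℕ) : Cochain k Γ n →ₗ[k] Cochain k Γ (n+1) :=
  ((groupCohomology.inhomogeneousCochains (Rep.trivial k Γ k)).d n (n+1)).hom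

/-- The homology class of a cycle. -/
def homologyClass (n : ℕ) : LinearMap.ker (bd k Γ n) →ₗ[k] H k Γ (n+1) :=
  classMap (groupHomology.inhomogeneousChains (Rep.trivial k Γ k)) (n+1) n (ChainComplex.next_nat_succ n)

/-- The cohomology class of a cocycle. -/
def cohomologyClass (n : ℕ) : LinearMap.ker (cobd k Γ n) →ₗ[k] Coh k Γ n :=
  classMap (groupCohomology.inhomogeneousCochains (Rep.trivial k Γ k)) n (n+1) (CochainComplex.next ℕ n)

lemma homologyClass_surjective (n : ℕ) : Function.Surjective (homologyClass k Γ n) :=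
  classMap_surjective _ _ _ _

lemma cohomologyClass_surjective (n : ℕ) : Function.Surjective (cohomologyClass k Γ n) :=
  classMap_surjective _ _ _ _

lemma homologyClass_eq_zero_iff (n : ℕ) (z : LinearMap.ker (bd k Γ n)) :
    homologyClass k Γ n z = 0 ↔ ∃ w, bd k Γ (n+1) w = z :=
  classMap_eq_zero_iff (groupHomology.inhomogeneousChains (Rep.trivial k Γ k)) (n+2) (n+1) n (ChainComplex.prev ℕ (n+1)) (ChainComplex.next_nat_succ n) z

lemma cohomologyClass_eq_zero_iff (n : ℕ) (z : LinearMap.ker (cobd k Γ (n+1))) :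
    cohomologyClass k Γ (n+1) z = 0 ↔ ∃ w, cobd k Γ n w = z :=
  classMap_eq_zero_iff (groupCohomology.inhomogeneousCochains (Rep.trivial k Γ k)) n (n+1) (n+2) (CochainComplex.prev_nat_succ n) (CochainComplex.next ℕ (n+1)) z

variable {k Γ}
lemma bd_single (n : ℕ) (g : Fin (n + 1) → Γ) (a : k) :
    bd k Γ n (Finsupp.single g a) = Finsupp.single (fun i => g i.succ) a +
      ∑ j : Fin (n + 1), (-1 : k) ^ ((j : ℕ) + 1) •
        Finsupp.single (Fin.contractNth j (· * ·) g) a := by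
  unfold bd
  rw [groupHomology.inhomogeneousChains.d_def]
  exact groupHomology.inhomogeneousChains.d_single (A := Rep.trivial k Γ k) n g a

lemma cobd_apply (n : ℕ) (f : Cochain k Γ n) (g : Fin (n+1) → Γ) :
    cobd k Γ n f g = f (fun i => g i.succ) +
      ∑ j : Fin (n + 1), (-1 : k) ^ ((j : ℕ) + 1) * f (Fin.contractNth j (· * ·) g) := by
  unfold cobd
  rw [groupCohomology.inhomogeneousCochains.d_def]
  rfl

lemma bd_bd (n : ℕ) (x : Chain k Γ (n+2)) : bd k Γ n (bd k Γ (n+1) x) = 0 :=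
  congrArg (fun φ : (groupHomology.inhomogeneousChains (Rep.trivial k Γ k)).X (n+2) ⟶
    (groupHomology.inhomogeneousChains (Rep.trivial k Γ k)).X n => φ.hom x)
    ((groupHomology.inhomogeneousChains (Rep.trivial k Γ k)).d_comp_d (n+2) (n+1) n)

/-- Evaluation of a cochain on a chain. -/
def evalChain (n : ℕ) : Cochain k Γ n →ₗ[k] Chain k Γ n →ₗ[k] k :=
  (Finsupp.lsum k).toLinearMap ∘ₗ  LinearMap.compLeft (LinearMap.lsmul k k) _ 

lemma evalChain_single (n : ℕ) (f : Cochain k Γ n) (g : Fin n → Γ) (a : k) :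
    evalChain n f (Finsupp.single g a) = f g * a := by
  simp [evalChain]

lemma evalChain_cobd (n : ℕ) (f : Cochain k Γ n) (x : Chain k Γ (n+1)) :
    evalChain (n+1) (cobd k Γ n f) x = evalChain n f (bd k Γ n x) := by
  induction x using Finsupp.induction_linear with
  | zero => simp
  | add x y hx hy => simp only [map_add, hx, hy]
  | single g a =>
    rw [evalChain_single, bd_single, cobd_apply]
    simp only [map_add, map_sum, map_smul, evalChain_single, add_mul, Finset.sum_mul, mul_assoc,
      smul_eq_mul]

/-- Evaluation of a cocycle on a cycle. -/
def evalCocycle (n : ℕ) :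
    LinearMap.ker (cobd k Γ (n+1)) →ₗ[k] LinearMap.ker (bd k Γ n) →ₗ[k] k :=
  (evalChain (n+1)).domRestrict₁₂ _ _

lemma evalCocycle_apply (n : ℕ) (f : LinearMap.ker (cobd k Γ (n+1)))
    (z : LinearMap.ker (bd k Γ n)) : evalCocycle n f z = evalChain (n+1) f.1 z.1 := rfl

/-- The Kronecker pairing `H^{n+1}(BΓ; k) × H_{n+1}(BΓ; k) → k`. -/
def pairing (n : ℕ) : Coh k Γ (n+1) →ₗ[k] H k Γ (n+1) →ₗ[k] k :=
  descend₂ (A := LinearMap.ker (cobd k Γ (n+1))) (B := LinearMap.ker (bd k Γ n)) (M := k)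
    (cohomologyClass k Γ (n+1)) (cohomologyClass_surjective k Γ (n+1))
    (homologyClass k Γ n) (homologyClass_surjective k Γ n) (evalCocycle n)
    (fun f hf z => by
      obtain ⟨e, he⟩ := (cohomologyClass_eq_zero_iff k Γ n f).1 hf
      rw [evalCocycle_apply, ← he, evalChain_cobd, LinearMap.mem_ker.1 z.2, map_zero])
    (fun f z hz => by
      obtain ⟨w, hw⟩ := (homologyClass_eq_zero_iff k Γ n z).1 hz
      rw [evalCocycle_apply, ← hw, ← evalChain_cobd, LinearMap.mem_ker.1 f.2, map_zero,
        LinearMap.zero_apply])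

lemma pairing_class (n : ℕ) (f : LinearMap.ker (cobd k Γ (n+1))) (z : LinearMap.ker (bd k Γ n)) :
    pairing n (cohomologyClass k Γ (n+1) f) (homologyClass k Γ n z) = evalChain (n+1) f.1 z.1 := by
  unfold pairing
  exact descend₂_apply (A := LinearMap.ker (cobd k Γ (n+1))) (B := LinearMap.ker (bd k Γ n))
    (M := k) _ _ _ _ _ _ _ f z

lemma cobd_one (e : Cochain k Γ 1) (a b : Γ) :
    cobd k Γ 1 e ![a, b] = e ![b] - e ![a * b] + e ![a] := by
  rw [cobd_apply]
  have h0 : (fun i : Fin 1 => ![a, b] i.succ) = ![b] := by ext i; fin_cases i; rfl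
  have h1 : Fin.contractNth 0 (· * ·) ![a, b] = ![a * b] := by ext i; fin_cases i; rfl
  have h2 : Fin.contractNth 1 (· * ·) ![a, b] = ![a] := by ext i; fin_cases i; rfl
  rw [Fin.sum_univ_two, h0, h1, h2]
  simp; ring

lemma cobd_two (e : Cochain k Γ 2) (a b c : Γ) :
    cobd k Γ 2 e ![a, b, c] = e ![b, c] - e ![a * b, c] + e ![a, b * c] - e ![a, b] := by
  rw [cobd_apply]
  have h0 : (fun i : Fin 2 => ![a, b, c] i.succ) = ![b, c] := by ext i; fin_cases i <;> rfl
  have h1 : Fin.contractNth 0 (· * ·) ![a, b, c] = ![a * b, c] := by ext i; fin_cases i <;> rfl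
  have h2 : Fin.contractNth 1 (· * ·) ![a, b, c] = ![a, b * c] := by ext i; fin_cases i <;> rfl
  have h3 : Fin.contractNth 2 (· * ·) ![a, b, c] = ![a, b] := by ext i; fin_cases i <;> rfl
  rw [Fin.sum_univ_three, h0, h1, h2, h3]
  simp; ring

lemma cobd_three (e : Cochain k Γ 3) (a b c d : Γ) :
    cobd k Γ 3 e ![a, b, c, d] = e ![b, c, d] - e ![a * b, c, d] + e ![a, b * c, d]
      - e ![a, b, c * d] + e ![a, b, c] := by
  rw [cobd_apply]
  have h0 : (fun i : Fin 3 => ![a, b, c, d] i.succ) = ![b, c, d] := by ext i; fin_cases i <;> rfl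
  have h1 : Fin.contractNth 0 (· * ·) ![a, b, c, d] = ![a * b, c, d] := by
    ext i; fin_cases i <;> rfl
  have h2 : Fin.contractNth 1 (· * ·) ![a, b, c, d] = ![a, b * c, d] := by
    ext i; fin_cases i <;> rfl
  have h3 : Fin.contractNth 2 (· * ·) ![a, b, c, d] = ![a, b, c * d] := by
    ext i; fin_cases i <;> rfl
  have h4 : Fin.contractNth 3 (· * ·) ![a, b, c, d] = ![a, b, c] := by
    ext i; fin_cases i <;> rfl
  rw [Fin.sum_univ_four, h0, h1, h2, h3, h4]
  simp; ring

lemma cobd_four (e : Cochain k Γ 4) (a b c d f : Γ) :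
    cobd k Γ 4 e ![a, b, c, d, f] = e ![b, c, d, f] - e ![a * b, c, d, f] + e ![a, b * c, d, f]
      - e ![a, b, c * d, f] + e ![a, b, c, d * f] - e ![a, b, c, d] := by
  rw [cobd_apply]
  have h0 : (fun i : Fin 4 => ![a, b, c, d, f] i.succ) = ![b, c, d, f] := by
    ext i; fin_cases i <;> rfl
  have h1 : Fin.contractNth 0 (· * ·) ![a, b, c, d, f] = ![a * b, c, d, f] := by
    ext i; fin_cases i <;> rfl
  have h2 : Fin.contractNth 1 (· * ·) ![a, b, c, d, f] = ![a, b * c, d, f] := by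
    ext i; fin_cases i <;> rfl
  have h3 : Fin.contractNth 2 (· * ·) ![a, b, c, d, f] = ![a, b, c * d, f] := by
    ext i; fin_cases i <;> rfl
  have h4 : Fin.contractNth 3 (· * ·) ![a, b, c, d, f] = ![a, b, c, d * f] := by
    ext i; fin_cases i <;> rfl
  have h5 : Fin.contractNth 4 (· * ·) ![a, b, c, d, f] = ![a, b, c, d] := by
    ext i; fin_cases i <;> rfl
  rw [Fin.sum_univ_five, h0, h1, h2, h3, h4, h5]
  simp; ring

/-- The cup product of inhomogeneous cochains,
`(f ∪ g)(x₁, …, x_{m+n}) = f(x₁, …, x_m) g(x_{m+1}, …, x_{m+n})`. -/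
def cupCochain (m n : ℕ) : Cochain k Γ m →ₗ[k] Cochain k Γ n →ₗ[k] Cochain k Γ (m + n) :=
  LinearMap.mk₂ k (fun f g x => f (fun i => x (Fin.castAdd n i)) * g (fun i => x (Fin.natAdd m i)))
    (fun f f' g => by ext x; simp [add_mul]) (fun c f g => by ext x; simp [mul_assoc])
    (fun f g g' => by ext x; simp [mul_add]) (fun c f g => by ext x; simp [mul_left_comm])

lemma cup_apply_two_two (f g : Cochain k Γ 2) (a b c d : Γ) :
    cupCochain 2 2 f g ![a, b, c, d] = f ![a, b] * g ![c, d] := by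
  change f _ * g _ = _
  congr 2 <;> (ext i; fin_cases i <;> rfl)

lemma cup_apply_one_two (f : Cochain k Γ 1) (g : Cochain k Γ 2) (a b c : Γ) :
    cupCochain 1 2 f g ![a, b, c] = f ![a] * g ![b, c] := by
  change f _ * g _ = _
  congr 2 <;> (ext i; fin_cases i <;> rfl)

lemma cup_apply_two_one (f : Cochain k Γ 2) (g : Cochain k Γ 1) (a b c : Γ) :
    cupCochain 2 1 f g ![a, b, c] = f ![a, b] * g ![c] := by
  change f _ * g _ = _
  congr 2 <;> (ext i; fin_cases i <;> rfl)

lemma vec_four (x : Fin 4 → Γ) : x = ![x 0, x 1, x 2, x 3] := by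
  ext i; fin_cases i <;> rfl

lemma vec_five (x : Fin 5 → Γ) : x = ![x 0, x 1, x 2, x 3, x 4] := by
  ext i; fin_cases i <;> rfl

lemma cup_mem (f g : LinearMap.ker (cobd k Γ 2)) :
    cupCochain 2 2 f.1 g.1 ∈ LinearMap.ker (cobd k Γ 4) := by
  rw [LinearMap.mem_ker]
  funext x
  rw [vec_five x]
  generalize x 0 = a, x 1 = b, x 2 = c, x 3 = d, x 4 = e
  have hf := congrFun (LinearMap.mem_ker.1 f.2) ![a, b, c]
  have hg := congrFun (LinearMap.mem_ker.1 g.2) ![c, d, e]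
  rw [cobd_two] at hf hg
  rw [cobd_four]
  simp only [cup_apply_two_two, Pi.zero_apply] at hf hg ⊢
  linear_combination g.1 ![d, e] * hf + f.1 ![a, b] * hg

/-- The cup product `H²(BΓ; k) × H²(BΓ; k) → H⁴(BΓ; k)`. -/
def cup : Coh k Γ 2 →ₗ[k] Coh k Γ 2 →ₗ[k] Coh k Γ 4 :=
  descend₂ (cohomologyClass k Γ 2) (cohomologyClass_surjective k Γ 2)
    (cohomologyClass k Γ 2) (cohomologyClass_surjective k Γ 2)
    (LinearMap.mk₂ k (fun f g => cohomologyClass k Γ 4 ⟨cupCochain 2 2 f.1 g.1, cup_mem f g⟩)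
      (fun f f' g => by rw [← map_add]; congr 1; ext1; simp)
      (fun c f g => by rw [← map_smul]; congr 1; ext1; simp)
      (fun f g g' => by rw [← map_add]; congr 1; ext1; simp)
      (fun c f g => by rw [← map_smul]; congr 1; ext1; simp))
    (fun f hf g => by
      obtain ⟨e, he⟩ := (cohomologyClass_eq_zero_iff k Γ 1 f).1 hf
      refine (cohomologyClass_eq_zero_iff k Γ 3 _).2 ⟨cupCochain 1 2 e g.1, ?_⟩
      funext x
      rw [vec_four x]
      generalize x 0 = a, x 1 = b, x 2 = c, x 3 = d
      have hg := congrFun (LinearMap.mem_ker.1 g.2) ![b, c, d]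
      rw [cobd_two] at hg
      rw [cobd_three]
      simp only [cup_apply_two_two, cup_apply_one_two, ← he, cobd_one, Pi.zero_apply] at hg ⊢
      linear_combination - e ![a] * hg)
    (fun f g hg => by
      obtain ⟨e, he⟩ := (cohomologyClass_eq_zero_iff k Γ 1 g).1 hg
      refine (cohomologyClass_eq_zero_iff k Γ 3 _).2 ⟨cupCochain 2 1 f.1 e, ?_⟩
      funext x
      rw [vec_four x]
      generalize x 0 = a, x 1 = b, x 2 = c, x 3 = d
      have hf := congrFun (LinearMap.mem_ker.1 f.2) ![a, b, c]
      rw [cobd_two] at hf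
      rw [cobd_three]
      simp only [cup_apply_two_two, cup_apply_two_one, ← he, cobd_one, Pi.zero_apply] at hf ⊢
      linear_combination e ![d] * hf)

lemma cup_class (f g : LinearMap.ker (cobd k Γ 2)) :
    cup (cohomologyClass k Γ 2 f) (cohomologyClass k Γ 2 g) =
      cohomologyClass k Γ 4 ⟨cupCochain 2 2 f.1 g.1, cup_mem f g⟩ :=
  descend₂_apply _ _ _ _ _ _ _ _ _

/-- The map `f_* : H_n(BΓ; k) → H_n(BΔ; k)` induced by a group homomorphism. -/
def homologyMap (k : Type) [CommRing k] {Γ Δ : Type} [Group Γ] [Group Δ] (f : Γ →* Δ) (n : ℕ) :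
    H k Γ n →ₗ[k] H k Δ n :=
  (groupHomology.map f (𝟙 _ : Rep.trivial k Γ k ⟶ Rep.res f (Rep.trivial k Δ k)) n).hom

end Homology

section Gysin

variable {E G : Type} [Group E] [Group G]

lemma bd_one (a b : E) (t : ℤ) : bd ℤ E 1 (Finsupp.single ![a, b] t) =
    Finsupp.single ![b] t - Finsupp.single ![a * b] t + Finsupp.single ![a] t := by
  rw [bd_single]
  have h0 : (fun i : Fin 1 => ![a, b] i.succ) = ![b] := by ext i; fin_cases i; rfl
  have h1 : Fin.contractNth 0 (· * ·) ![a, b] = ![a * b] := by ext i; fin_cases i; rfl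
  have h2 : Fin.contractNth 1 (· * ·) ![a, b] = ![a] := by ext i; fin_cases i; rfl
  rw [Fin.sum_univ_two, h0, h1, h2]
  simp; abel

lemma bd_two (a b c : E) (t : ℤ) : bd ℤ E 2 (Finsupp.single ![a, b, c] t) =
    Finsupp.single ![b, c] t - Finsupp.single ![a * b, c] t + Finsupp.single ![a, b * c] t
      - Finsupp.single ![a, b] t := by
  rw [bd_single]
  have h0 : (fun i : Fin 2 => ![a, b, c] i.succ) = ![b, c] := by ext i; fin_cases i <;> rfl
  have h1 : Fin.contractNth 0 (· * ·) ![a, b, c] = ![a * b, c] := by ext i; fin_cases i <;> rfl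
  have h2 : Fin.contractNth 1 (· * ·) ![a, b, c] = ![a, b * c] := by ext i; fin_cases i <;> rfl
  have h3 : Fin.contractNth 2 (· * ·) ![a, b, c] = ![a, b] := by ext i; fin_cases i <;> rfl
  rw [Fin.sum_univ_three, h0, h1, h2, h3]
  simp; abel

lemma bd_three (a b c d : E) (t : ℤ) : bd ℤ E 3 (Finsupp.single ![a, b, c, d] t) =
    Finsupp.single ![b, c, d] t - Finsupp.single ![a * b, c, d] t
      + Finsupp.single ![a, b * c, d] t - Finsupp.single ![a, b, c * d] t
      + Finsupp.single ![a, b, c] t := by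
  rw [bd_single]
  have h0 : (fun i : Fin 3 => ![a, b, c, d] i.succ) = ![b, c, d] := by ext i; fin_cases i <;> rfl
  have h1 : Fin.contractNth 0 (· * ·) ![a, b, c, d] = ![a * b, c, d] := by
    ext i; fin_cases i <;> rfl
  have h2 : Fin.contractNth 1 (· * ·) ![a, b, c, d] = ![a, b * c, d] := by
    ext i; fin_cases i <;> rfl
  have h3 : Fin.contractNth 2 (· * ·) ![a, b, c, d] = ![a, b, c * d] := by
    ext i; fin_cases i <;> rfl
  have h4 : Fin.contractNth 3 (· * ·) ![a, b, c, d] = ![a, b, c] := by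
    ext i; fin_cases i <;> rfl
  rw [Fin.sum_univ_four, h0, h1, h2, h3, h4]
  simp; abel

/-- The shuffle product with the `1`-cycle `[z]`,
`[g₁|…|gₙ] ↦ ∑ᵢ (-1)ⁱ [g₁|…|gᵢ|z|gᵢ₊₁|…|gₙ]`. For `z` central this is, on chains, the map
`S¹ × BE → BE` which on fundamental groups is `(m, x) ↦ zᵐ x`, applied to `[S¹] × (-)`. -/
def shuffle (z : E) (n : ℕ) : Chain ℤ E n →ₗ[ℤ] Chain ℤ E (n+1) :=
  Finsupp.lsum ℤ fun g => ∑ i : Fin (n + 1), (-1 : ℤ) ^ (i : ℕ) •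
    Finsupp.lsingle (Fin.insertNth i z g)

lemma shuffle_single (z : E) (n : ℕ) (g : Fin n → E) (t : ℤ) :
    shuffle z n (Finsupp.single g t) =
      ∑ i : Fin (n + 1), (-1 : ℤ) ^ (i : ℕ) • Finsupp.single (Fin.insertNth i z g) t := by
  simp only [shuffle, Finsupp.lsum_single, LinearMap.sum_apply, LinearMap.smul_apply,
    Finsupp.lsingle_apply]

lemma shuffle_one (z a : E) (t : ℤ) : shuffle z 1 (Finsupp.single ![a] t) =
    Finsupp.single ![z, a] t - Finsupp.single ![a, z] t := by
  have h0 : Fin.insertNth (0 : Fin 2) z ![a] = (![z, a] : Fin 2 → E) := by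
    ext i; fin_cases i <;> rfl
  have h1 : Fin.insertNth (1 : Fin 2) z ![a] = (![a, z] : Fin 2 → E) := by
    ext i; fin_cases i <;> rfl
  rw [shuffle_single, Fin.sum_univ_two, h0, h1]
  simp [sub_eq_add_neg]

lemma shuffle_two (z a b : E) (t : ℤ) : shuffle z 2 (Finsupp.single ![a, b] t) =
    Finsupp.single ![z, a, b] t - Finsupp.single ![a, z, b] t + Finsupp.single ![a, b, z] t := by
  have h0 : Fin.insertNth (0 : Fin 3) z ![a, b] = (![z, a, b] : Fin 3 → E) := by
    ext i; fin_cases i <;> rfl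
  have h1 : Fin.insertNth (1 : Fin 3) z ![a, b] = (![a, z, b] : Fin 3 → E) := by
    ext i; fin_cases i <;> rfl
  have h2 : Fin.insertNth (2 : Fin 3) z ![a, b] = (![a, b, z] : Fin 3 → E) := by
    ext i; fin_cases i <;> rfl
  rw [shuffle_single, Fin.sum_univ_three, h0, h1, h2]
  simp [sub_eq_add_neg]

lemma shuffle_three (z a b c : E) (t : ℤ) : shuffle z 3 (Finsupp.single ![a, b, c] t) =
    Finsupp.single ![z, a, b, c] t - Finsupp.single ![a, z, b, c] t
      + Finsupp.single ![a, b, z, c] t - Finsupp.single ![a, b, c, z] t := by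
  have h0 : Fin.insertNth (0 : Fin 4) z ![a, b, c] = (![z, a, b, c] : Fin 4 → E) := by
    ext i; fin_cases i <;> rfl
  have h1 : Fin.insertNth (1 : Fin 4) z ![a, b, c] = (![a, z, b, c] : Fin 4 → E) := by
    ext i; fin_cases i <;> rfl
  have h2 : Fin.insertNth (2 : Fin 4) z ![a, b, c] = (![a, b, z, c] : Fin 4 → E) := by
    ext i; fin_cases i <;> rfl
  have h3 : Fin.insertNth (3 : Fin 4) z ![a, b, c] = (![a, b, c, z] : Fin 4 → E) := by
    ext i; fin_cases i <;> rfl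
  rw [shuffle_single, Fin.sum_univ_four, h0, h1, h2, h3]
  simp [sub_eq_add_neg]

lemma vec_one (x : Fin 1 → E) : x = ![x 0] := by ext i; fin_cases i; rfl
lemma vec_two (x : Fin 2 → E) : x = ![x 0, x 1] := by ext i; fin_cases i <;> rfl
lemma vec_three (x : Fin 3 → E) : x = ![x 0, x 1, x 2] := by ext i; fin_cases i <;> rfl

lemma chain_one_induction {P : Chain ℤ E 1 → Prop} (x : Chain ℤ E 1) (h0 : P 0)
    (hadd : ∀ x y, P x → P y → P (x + y)) (hs : ∀ a t, P (Finsupp.single ![a] t)) : P x := by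
  induction x using Finsupp.induction_linear with
  | zero => exact h0
  | add x y hx hy => exact hadd x y hx hy
  | single g t => rw [vec_one g]; exact hs _ t

lemma chain_two_induction {P : Chain ℤ E 2 → Prop} (x : Chain ℤ E 2) (h0 : P 0)
    (hadd : ∀ x y, P x → P y → P (x + y)) (hs : ∀ a b t, P (Finsupp.single ![a, b] t)) : P x := by
  induction x using Finsupp.induction_linear with
  | zero => exact h0
  | add x y hx hy => exact hadd x y hx hy
  | single g t => rw [vec_two g]; exact hs _ _ t

lemma chain_three_induction {P : Chain ℤ E 3 → Prop} (x : Chain ℤ E 3) (h0 : P 0)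
    (hadd : ∀ x y, P x → P y → P (x + y)) (hs : ∀ a b c t, P (Finsupp.single ![a, b, c] t)) :
    P x := by
  induction x using Finsupp.induction_linear with
  | zero => exact h0
  | add x y hx hy => exact hadd x y hx hy
  | single g t => rw [vec_three g]; exact hs _ _ _ t

/-- `1 → ⟨z⟩ → E → G → 1` is a central extension with `⟨z⟩` infinite cyclic. -/
structure IsCentralExtension (p : E →* G) (z : E) : Prop where
  surjective : Function.Surjective p
  central : ∀ x, z * x = x * z
  ker : ∀ x, p x = 1 ↔ ∃ n : ℤ, x = z ^ n
  infinite : ∀ n : ℤ, z ^ n = 1 → n = 0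

lemma bd_shuffle_two (z : E) (hz : ∀ x, z * x = x * z) (x : Chain ℤ E 2) :
    bd ℤ E 2 (shuffle z 2 x) = - shuffle z 1 (bd ℤ E 1 x) := by
  induction x using chain_two_induction with
  | h0 => simp
  | hadd x y hx hy => simp only [map_add, hx, hy]; abel
  | hs a b t =>
    simp only [shuffle_two, bd_one, map_add, map_sub, bd_two, shuffle_one, hz]
    abel

lemma bd_shuffle_three (z : E) (hz : ∀ x, z * x = x * z) (x : Chain ℤ E 3) :
    bd ℤ E 3 (shuffle z 3 x) = - shuffle z 2 (bd ℤ E 2 x) := by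
  induction x using chain_three_induction with
  | h0 => simp
  | hadd x y hx hy => simp only [map_add, hx, hy]; abel
  | hs a b c t =>
    simp only [shuffle_three, bd_two, map_add, map_sub, bd_three, shuffle_two, hz]
    abel

/-- The map on inhomogeneous chains induced by a group homomorphism. -/
def push (k : Type) [CommRing k] (f : E →* G) (n : ℕ) : Chain k E n →ₗ[k] Chain k G n :=
  Finsupp.lmapDomain k k (fun x i => f (x i))

lemma push_single (k : Type) [CommRing k] (f : E → G) (n : ℕ) (x : Fin n → E) (t : k) :
    Finsupp.lmapDomain k k (fun (x : Fin n → E) i => f (x i)) (Finsupp.single x t) = Finsupp.single (fun i => f (x i)) t :=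
  Finsupp.mapDomain_single

lemma bd_push (k : Type) [CommRing k] (f : E →* G) (n : ℕ) (x : Chain k E (n + 1)) :
    bd k G n (push k f (n+1) x) = push k f n (bd k E n x) := by
  induction x using Finsupp.induction_linear with
  | zero => simp
  | add x y hx hy => simp only [map_add, hx, hy]
  | single g t =>
    unfold push
    rw [push_single, bd_single, bd_single]
    simp only [map_add, map_sum, map_smul, push_single]
    congr 1
    refine Finset.sum_congr rfl fun j _ => ?_
    congr 2
    have := Fin.comp_contractNth (· * ·) (· * ·) (f := f) (fun a b => map_mul f a b) j g
    exact this.symm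


variable {p : E →* G} {z : E}

lemma IsCentralExtension.comm_zpow (h : IsCentralExtension p z) (n : ℤ) (x : E) :
    z ^ n * x = x * z ^ n :=
  ((show Commute z x from h.central x).zpow_left n).eq

lemma IsCentralExtension.map_zpow (h : IsCentralExtension p z) (n : ℤ) : p (z ^ n) = 1 :=
  (h.ker _).2 ⟨n, rfl⟩

lemma push_two (a b : E) (t : ℤ) : push ℤ p 2 (Finsupp.single ![a, b] t) =
    Finsupp.single ![p a, p b] t := by
  unfold push
  rw [push_single]
  congr 1; ext i; fin_cases i <;> rfl

lemma push_one (a : E) (t : ℤ) : push ℤ p 1 (Finsupp.single ![a] t) =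
    Finsupp.single ![p a] t := by
  unfold push
  rw [push_single]
  congr 1; ext i; fin_cases i; rfl

/-- The linear map `[g] ↦ [z g]`. -/
def tau (z : E) : Chain ℤ E 1 →ₗ[ℤ] Chain ℤ E 1 := Finsupp.lmapDomain ℤ ℤ (fun x => ![z * x 0])

lemma tau_single (z a : E) (t : ℤ) : tau z (Finsupp.single ![a] t) =
    Finsupp.single ![z * a] t := Finsupp.mapDomain_single

lemma tau_fixed (h : IsCentralExtension p z) (M : Chain ℤ E 1) (hM : tau z M = M) : M = 0 := by
  have hinj : Function.Injective (fun x : Fin 1 → E => ![z * x 0]) := by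
    intro x y hxy
    have := congrFun hxy 0
    rw [vec_one x, vec_one y]
    simpa using this
  have h1 : ∀ x : Fin 1 → E, M ![z * x 0] = M x := fun x => by
    conv_lhs => rw [← hM]
    exact Finsupp.mapDomain_apply hinj M x
  have h2 : ∀ (n : ℕ) (a : E), M ![z ^ n * a] = M ![a] := by
    intro n a
    induction n with
    | zero => simp
    | succ n ih => rw [pow_succ', mul_assoc, ← ih]; exact h1 ![z ^ n * a]
  by_contra hne
  obtain ⟨x, hx⟩ := Finsupp.ne_iff.1 hne
  have hinj2 : Function.Injective (fun n : ℕ => (![z ^ n * x 0] : Fin 1 → E)) := by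
    intro m n hmn
    have h3 : z ^ m * x 0 = z ^ n * x 0 := congrFun hmn 0
    have h4 := mul_right_cancel h3
    have h5 := h.infinite ((m : ℤ) - n) (by
      rw [zpow_sub, zpow_natCast, zpow_natCast, h4, mul_inv_cancel])
    omega
  refine Set.infinite_range_of_injective hinj2 (M.support.finite_toSet.subset ?_)
  rintro _ ⟨n, rfl⟩
  simp only [Finset.mem_coe, Finsupp.mem_support_iff, h2]
  rw [← vec_one x]; exact hx

/-- The sum of the coefficients of a `1`-chain. -/
def aug : Chain ℤ E 1 →ₗ[ℤ] ℤ := Finsupp.lsum ℤ fun _ => LinearMap.id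

lemma aug_single (a : Fin 1 → E) (t : ℤ) : aug (Finsupp.single a t) = t := by simp [aug]

/-- The linear map `[g] ↦ [z|g]`. -/
def preZ (z : E) : Chain ℤ E 1 →ₗ[ℤ] Chain ℤ E 2 := Finsupp.lmapDomain ℤ ℤ fun x => ![z, x 0]

/-- The linear map `[g] ↦ [g|z]`. -/
def postZ (z : E) : Chain ℤ E 1 →ₗ[ℤ] Chain ℤ E 2 := Finsupp.lmapDomain ℤ ℤ fun x => ![x 0, z]

lemma preZ_single (z a : E) (t : ℤ) : preZ z (Finsupp.single ![a] t) =
    Finsupp.single ![z, a] t := Finsupp.mapDomain_single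
lemma postZ_single (z a : E) (t : ℤ) : postZ z (Finsupp.single ![a] t) =
    Finsupp.single ![a, z] t := Finsupp.mapDomain_single

lemma bd_preZ (M : Chain ℤ E 1) :
    bd ℤ E 1 (preZ z M) = M - tau z M + aug M • Finsupp.single ![z] 1 := by
  induction M using chain_one_induction with
  | h0 => simp
  | hadd x y hx hy => simp only [map_add, hx, hy, add_smul]; abel
  | hs a t => rw [preZ_single, bd_one, tau_single, aug_single, Finsupp.smul_single_one]

lemma bd_postZ (hz : ∀ x, z * x = x * z) (M : Chain ℤ E 1) :
    bd ℤ E 1 (postZ z M) = M - tau z M + aug M • Finsupp.single ![z] 1 := by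
  induction M using chain_one_induction with
  | h0 => simp
  | hadd x y hx hy => simp only [map_add, hx, hy, add_smul]; abel
  | hs a t =>
    rw [postZ_single, bd_one, tau_single, aug_single, Finsupp.smul_single_one, hz]; abel

lemma shuffle_preZ (M : Chain ℤ E 1) : shuffle z 2 (preZ z M) = shuffle z 2 (postZ z M) := by
  induction M using chain_one_induction with
  | h0 => simp
  | hadd x y hx hy => simp only [map_add, hx, hy]
  | hs a t => rw [preZ_single, postZ_single, shuffle_two, shuffle_two]; abel

lemma aug_tau (M : Chain ℤ E 1) : aug (tau z M) = aug M := by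
  induction M using chain_one_induction with
  | h0 => simp
  | hadd x y hx hy => simp only [map_add, hx, hy]
  | hs a t => rw [tau_single, aug_single, aug_single]

/-- The span of all boundaries, all `[z|g]` and all `[g|z]`. -/
def fibrePart (z : E) : Submodule ℤ (Chain ℤ E 2) :=
  LinearMap.range (bd ℤ E 2) ⊔ LinearMap.range (preZ z) ⊔ LinearMap.range (postZ z)

lemma mem_fibrePart_bd (x : Chain ℤ E 3) : bd ℤ E 2 x ∈ fibrePart z :=
  Submodule.mem_sup_left (Submodule.mem_sup_left ⟨x, rfl⟩)
lemma mem_fibrePart_pre (a : E) (t : ℤ) : Finsupp.single ![z, a] t ∈ fibrePart z :=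
  Submodule.mem_sup_left (Submodule.mem_sup_right ⟨Finsupp.single ![a] t, preZ_single _ _ _⟩)
lemma mem_fibrePart_post (a : E) (t : ℤ) : Finsupp.single ![a, z] t ∈ fibrePart z :=
  Submodule.mem_sup_right ⟨Finsupp.single ![a] t, postZ_single _ _ _⟩

lemma fibrePart_left (a b : E) (t : ℤ) :
    (Finsupp.single ![z * a, b] t - Finsupp.single ![a, b] t : Chain ℤ E 2) ∈ fibrePart z := by
  have h := bd_two z a b t
  have : (Finsupp.single ![z * a, b] t - Finsupp.single ![a, b] t : Chain ℤ E 2) =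
    Finsupp.single ![z, a * b] t - Finsupp.single ![z, a] t
      - bd ℤ E 2 (Finsupp.single ![z, a, b] t) := by rw [h]; abel
  rw [this]
  exact Submodule.sub_mem _ (Submodule.sub_mem _ (mem_fibrePart_pre _ _) (mem_fibrePart_pre _ _))
    (mem_fibrePart_bd _)

lemma fibrePart_right (hz : ∀ x, z * x = x * z) (a b : E) (t : ℤ) :
    (Finsupp.single ![a, z * b] t - Finsupp.single ![a, b] t : Chain ℤ E 2) ∈ fibrePart z := by
  have h := bd_two a z b t
  have : (Finsupp.single ![a, z * b] t - Finsupp.single ![a, b] t : Chain ℤ E 2) =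
    bd ℤ E 2 (Finsupp.single ![a, z, b] t) - Finsupp.single ![z, b] t + Finsupp.single ![a, z] t
      + (Finsupp.single ![z * a, b] t - Finsupp.single ![a, b] t) := by rw [h, hz a]; abel
  rw [this]
  exact Submodule.add_mem _ (Submodule.add_mem _ (Submodule.sub_mem _ (mem_fibrePart_bd _)
    (mem_fibrePart_pre _ _)) (mem_fibrePart_post _ _)) (fibrePart_left _ _ _)

lemma fibrePart_left_zpow (n : ℤ) (a b : E) (t : ℤ) :
    (Finsupp.single ![z ^ n * a, b] t - Finsupp.single ![a, b] t : Chain ℤ E 2) ∈ fibrePart z := by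
  induction n using Int.induction_on with
  | zero => simp
  | succ n ih =>
    have := Submodule.add_mem _ (fibrePart_left (z := z) (z ^ (n : ℤ) * a) b t) ih
    rw [sub_add_sub_cancel, ← mul_assoc, ← zpow_one_add, add_comm] at this
    exact this
  | pred n ih =>
    have := Submodule.sub_mem _ ih (fibrePart_left (z := z) (z ^ (-(n : ℤ) - 1) * a) b t)
    rw [← mul_assoc z, ← zpow_one_add, add_sub_cancel] at this
    convert this using 1; abel

lemma fibrePart_right_zpow (hz : ∀ x, z * x = x * z) (n : ℤ) (a b : E) (t : ℤ) :
    (Finsupp.single ![a, z ^ n * b] t - Finsupp.single ![a, b] t : Chain ℤ E 2) ∈ fibrePart z := by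
  induction n using Int.induction_on with
  | zero => simp
  | succ n ih =>
    have := Submodule.add_mem _ (fibrePart_right (z := z) hz a (z ^ (n : ℤ) * b) t) ih
    rw [sub_add_sub_cancel, ← mul_assoc, ← zpow_one_add, add_comm] at this
    exact this
  | pred n ih =>
    have := Submodule.sub_mem _ ih (fibrePart_right (z := z) hz a (z ^ (-(n : ℤ) - 1) * b) t)
    rw [← mul_assoc z, ← zpow_one_add, add_sub_cancel] at this
    convert this using 1; abel

/-- A set-theoretic section `s : G → E`. -/
def IsCentralExtension.sec (h : IsCentralExtension p z) : G → E := Function.surjInv h.surjective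

lemma IsCentralExtension.p_sec (h : IsCentralExtension p z) (g : G) : p (h.sec g) = g :=
  Function.surjInv_eq _ _

lemma IsCentralExtension.exists_zpow (h : IsCentralExtension p z) {a b : E} (hab : p a = p b) :
    ∃ n : ℤ, a = z ^ n * b := by
  obtain ⟨n, hn⟩ := (h.ker (a * b⁻¹)).1 (by rw [map_mul, map_inv, hab, mul_inv_cancel])
  exact ⟨n, by rw [← hn, inv_mul_cancel_right]⟩

/-- The map on chains induced by the section `s`. -/
def IsCentralExtension.lift (h : IsCentralExtension p z) (n : ℕ) :
    Chain ℤ G n →ₗ[ℤ] Chain ℤ E n := Finsupp.lmapDomain ℤ ℤ fun x i => h.sec (x i)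

lemma IsCentralExtension.lift_single (h : IsCentralExtension p z) (n : ℕ) (x : Fin n → G) (t : ℤ) :
    h.lift n (Finsupp.single x t) = Finsupp.single (fun i => h.sec (x i)) t :=
  Finsupp.mapDomain_single

lemma IsCentralExtension.push_lift (h : IsCentralExtension p z) (n : ℕ) (x : Chain ℤ G n) :
    push ℤ p n (h.lift n x) = x := by
  induction x using Finsupp.induction_linear with
  | zero => simp
  | add x y hx hy => simp only [map_add, hx, hy]
  | single g t =>
    rw [lift_single, push, push_single]
    simp only [h.p_sec]

lemma IsCentralExtension.sub_lift_mem (h : IsCentralExtension p z) (x : Chain ℤ E 2) :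
    x - h.lift 2 (push ℤ p 2 x) ∈ fibrePart z := by
  induction x using chain_two_induction with
  | h0 => simp
  | hadd x y hx hy =>
    simp only [map_add, add_sub_add_comm]
    exact Submodule.add_mem _ hx hy
  | hs a b t =>
    rw [push_two, lift_single]
    have : (fun i => h.sec (![p a, p b] i)) = ![h.sec (p a), h.sec (p b)] := by
      ext i; fin_cases i <;> rfl
    rw [this]
    obtain ⟨m, hm⟩ := h.exists_zpow (h.p_sec (p a)).symm
    obtain ⟨n, hn⟩ := h.exists_zpow (h.p_sec (p b)).symm
    have h1 := fibrePart_left_zpow (z := z) m (h.sec (p a)) b t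
    have h2 := fibrePart_right_zpow (z := z) h.central n (h.sec (p a)) (h.sec (p b)) t
    rw [← hm] at h1
    rw [← hn] at h2
    have := Submodule.add_mem _ h1 h2
    rwa [sub_add_sub_cancel] at this

/-- The key point for the Gysin map to be well defined. -/
lemma IsCentralExtension.shuffle_boundary (h : IsCentralExtension p z) (x : Chain ℤ E 2) (n : ℤ)
    (hx : bd ℤ E 1 x = n • Finsupp.single ![z] 1) (w : Chain ℤ G 3)
    (hw : bd ℤ G 2 w = push ℤ p 2 x - n • Finsupp.single ![1, 1] 1) :
    ∃ y, bd ℤ E 3 y = shuffle z 2 x := by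
  set x₁ : Chain ℤ E 2 := x - n • Finsupp.single ![1, 1] 1 - bd ℤ E 2 (h.lift 3 w) with hx₁
  have hp : push ℤ p 2 x₁ = 0 := by
    rw [hx₁, map_sub, map_sub, map_smul, push_two, ← bd_push, h.push_lift, hw, map_one]
    abel
  have hm := h.sub_lift_mem x₁
  rw [hp, map_zero, sub_zero] at hm
  obtain ⟨u, hu, v, ⟨M', rfl⟩, huv⟩ := Submodule.mem_sup.1 hm
  obtain ⟨u, ⟨y, rfl⟩, v, ⟨M, rfl⟩, rfl⟩ := Submodule.mem_sup.1 hu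
  have hb : bd ℤ E 1 x₁ = n • Finsupp.single ![z] 1 - n • Finsupp.single ![1] 1 := by
    rw [hx₁, map_sub, map_sub, map_smul, bd_one, bd_bd, hx, mul_one]
    module
  rw [← huv, map_add, map_add, bd_bd, bd_preZ, bd_postZ h.central] at hb
  have haug := congrArg aug hb
  simp only [map_add, map_sub, map_smul, aug_single, aug_tau, map_zero, smul_eq_mul] at haug
  have hsum : aug M + aug M' = 0 := by linarith
  have hfix : M + M' + n • Finsupp.single ![1] 1 = 0 := by
    apply tau_fixed h
    simp only [map_add, map_smul, tau_single, mul_one]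
    have h0 : aug M • Finsupp.single ![z] 1 + aug M' • Finsupp.single ![z] (1 : ℤ)
      = (0 : Chain ℤ E 1) := by rw [← add_smul, hsum, zero_smul]
    linear_combination (norm := module) h0 - hb
  have hn : n = 0 := by
    have := congrArg aug hfix
    simp only [map_add, map_smul, aug_single, map_zero, smul_eq_mul] at this
    linarith
  subst hn
  rw [zero_smul, add_zero] at hfix
  have hxx : x = bd ℤ E 2 (y + h.lift 3 w) + preZ z M + postZ z M' := by
    have e := huv.trans hx₁
    rw [map_add]
    linear_combination (norm := module) (-1 : ℤ) • e
  refine ⟨- shuffle z 3 (y + h.lift 3 w), ?_⟩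
  rw [map_neg, bd_shuffle_three z h.central, neg_neg]
  have h3 : shuffle z 2 (postZ z M) + shuffle z 2 (postZ z M') = 0 := by
    rw [← map_add, ← map_add, hfix, map_zero, map_zero]
  conv_rhs => rw [hxx, map_add, map_add, shuffle_preZ, add_assoc, h3, add_zero]


lemma IsCentralExtension.exists_fill (h : IsCentralExtension p z) (c : ℤ) :
    ∃ (F : Chain ℤ E 2) (r : ℤ), bd ℤ E 1 F = Finsupp.single ![z ^ c] 1 - c • Finsupp.single ![z] 1 ∧
      push ℤ p 2 F = r • Finsupp.single ![1, 1] 1 := by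
  have hz : p z = 1 := by simpa using h.map_zpow 1
  induction c using Int.induction_on with
  | zero => exact ⟨Finsupp.single ![1, 1] 1, 1, by rw [bd_one]; simp, by rw [push_two]; simp⟩
  | succ c ih =>
    obtain ⟨F, r, hF, hr⟩ := ih
    refine ⟨F - Finsupp.single ![z, z ^ (c : ℤ)] 1, r - 1, ?_, ?_⟩
    · rw [map_sub, hF, bd_one, add_comm (c : ℤ) 1, zpow_one_add, add_smul, one_smul]; abel
    · rw [map_sub, hr, push_two, hz, h.map_zpow, sub_smul, one_smul]
  | pred c ih =>
    obtain ⟨F, r, hF, hr⟩ := ih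
    refine ⟨F + Finsupp.single ![z, z ^ (-(c : ℤ) - 1)] 1, r + 1, ?_, ?_⟩
    · rw [map_add, hF, bd_one, ← zpow_one_add, add_sub_cancel, sub_smul, one_smul]; abel
    · rw [map_add, hr, push_two, hz, h.map_zpow, add_smul, one_smul]

lemma IsCentralExtension.exists_lift_chain (h : IsCentralExtension p z) (c : Chain ℤ G 2) :
    ∃ (x : Chain ℤ E 2) (n r : ℤ) (w : Chain ℤ G 3),
      bd ℤ E 1 x = h.lift 1 (bd ℤ G 1 c) + n • Finsupp.single ![z] 1 ∧
      push ℤ p 2 x = c + r • Finsupp.single ![1, 1] 1 + bd ℤ G 2 w := by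
  induction c using chain_two_induction with
  | h0 => exact ⟨0, 0, 0, 0, by simp, by simp⟩
  | hadd c d hc hd =>
    obtain ⟨x, n, r, w, h1, h2⟩ := hc
    obtain ⟨x', n', r', w', h1', h2'⟩ := hd
    refine ⟨x + x', n + n', r + r', w + w', ?_, ?_⟩
    · simp only [map_add, h1, h1', add_smul]; abel
    · simp only [map_add, h2, h2', add_smul]; abel
  | hs a b t =>
    obtain ⟨m, hm⟩ := h.exists_zpow (a := h.sec a * h.sec b) (b := h.sec (a * b))
      (by simp only [map_mul, h.p_sec])
    obtain ⟨F, r, hF, hr⟩ := h.exists_fill m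
    have hs1 : ∀ (g : G) (t : ℤ), h.lift 1 (Finsupp.single ![g] t) =
        Finsupp.single ![h.sec g] t := fun g t => by
      rw [h.lift_single]; congr 1; ext i; fin_cases i; rfl
    have ht : (Finsupp.single ![z ^ m] t : Chain ℤ E 1) = t • Finsupp.single ![z ^ m] 1 := by
      rw [Finsupp.smul_single_one]
    have ht2 : (Finsupp.single ![1, 1] t : Chain ℤ G 2) = t • Finsupp.single ![1, 1] 1 := by
      rw [Finsupp.smul_single_one]
    refine ⟨Finsupp.single ![h.sec a, h.sec b] t - Finsupp.single ![z ^ m, h.sec (a * b)] t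
      + t • F, - t * m, t * r - t, - Finsupp.single ![1, 1, a * b] t, ?_, ?_⟩
    · rw [map_add, map_sub, map_smul, bd_one, bd_one, bd_one, hF, map_add, map_sub, hs1, hs1, hs1,
        hm, ht]
      module
    · rw [map_add, map_sub, map_smul, push_two, push_two, hr, h.p_sec, h.p_sec, h.p_sec,
        h.map_zpow, map_neg, bd_two, one_mul, one_mul, ht2]
      module

lemma IsCentralExtension.exists_lift_cycle (h : IsCentralExtension p z) (c : Chain ℤ G 2)
    (hc : bd ℤ G 1 c = 0) : ∃ (x : Chain ℤ E 2) (n : ℤ) (w : Chain ℤ G 3),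
      bd ℤ E 1 x = n • Finsupp.single ![z] 1 ∧
      push ℤ p 2 x - n • Finsupp.single ![1, 1] 1 = c + bd ℤ G 2 w := by
  obtain ⟨x, n, r, w, h1, h2⟩ := h.exists_lift_chain c
  rw [hc, map_zero, zero_add] at h1
  have hz : p z = 1 := by simpa using h.map_zpow 1
  have h3 := congrArg (bd ℤ G 1) h2
  rw [bd_push, h1, map_add, map_add, hc, bd_bd, map_smul, map_smul, push_one, bd_one, hz,
    mul_one] at h3
  have h4 := congrArg aug h3
  simp only [map_add, map_sub, map_smul, aug_single, map_zero, smul_eq_mul] at h4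
  have h5 : n = r := by linarith
  exact ⟨x, n, w, h1, by rw [h2, h5]; abel⟩

/-- Pairs `(x, n)` of a `2`-chain `x` of `E` and an integer `n` with `∂x = n[z]`. Geometrically:
a surface with boundary `n` times the fibre circle, with a flat bundle with group `E`. -/
def liftedChains (z : E) : Submodule ℤ (Chain ℤ E 2 × ℤ) :=
  LinearMap.eqLocus (bd ℤ E 1 ∘ₗ LinearMap.fst ℤ _ _)
    ((LinearMap.toSpanSingleton ℤ _ (Finsupp.single ![z] 1)) ∘ₗ LinearMap.snd ℤ _ _)

lemma mem_liftedChains (z : E) (x : Chain ℤ E 2 × ℤ) :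
    x ∈ liftedChains z ↔ bd ℤ E 1 x.1 = x.2 • Finsupp.single ![z] 1 := Iff.rfl

lemma IsCentralExtension.baseCycle_mem (h : IsCentralExtension p z) (x : liftedChains z) :
    push ℤ p 2 x.1.1 - x.1.2 • Finsupp.single ![1, 1] 1 ∈ LinearMap.ker (bd ℤ G 1) := by
  have hx := (mem_liftedChains z x.1).1 x.2
  have hz : p z = 1 := by simpa using h.map_zpow 1
  rw [LinearMap.mem_ker, map_sub, bd_push, hx, map_smul, map_smul, push_one, bd_one, hz, mul_one]
  module

/-- The `2`-cycle `p_* x - n[1|1]` of `G`: the image in `BG` of the surface described by `x`, whose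
boundary (which is sent to a constant loop, `∂[1|1] = [1]`) is filled by discs. -/
def IsCentralExtension.baseCycle (h : IsCentralExtension p z) :
    liftedChains z →ₗ[ℤ] LinearMap.ker (bd ℤ G 1) where
  toFun x := ⟨push ℤ p 2 x.1.1 - x.1.2 • Finsupp.single ![1, 1] 1, h.baseCycle_mem x⟩
  map_add' x y := Subtype.ext (by
    simp only [Submodule.coe_add, Prod.fst_add, Prod.snd_add, map_add, add_smul]; abel)
  map_smul' c x := Subtype.ext (by
    simp only [Submodule.coe_smul, Prod.smul_fst, Prod.smul_snd, map_smul, RingHom.id_apply,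
      smul_sub, smul_assoc])

lemma IsCentralExtension.baseCycle_coe (h : IsCentralExtension p z) (x : liftedChains z) :
    (h.baseCycle x : Chain ℤ G 2) = push ℤ p 2 x.1.1 - x.1.2 • Finsupp.single ![1, 1] 1 := rfl

lemma IsCentralExtension.totalCycle_mem (h : IsCentralExtension p z) (x : liftedChains z) :
    shuffle z 2 x.1.1 ∈ LinearMap.ker (bd ℤ E 2) := by
  have hx := (mem_liftedChains z x.1).1 x.2
  rw [LinearMap.mem_ker, bd_shuffle_two z h.central, hx, map_smul, shuffle_one, sub_self,
    smul_zero, neg_zero]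

/-- The `3`-cycle `[z] × x` of `E`. -/
def IsCentralExtension.totalCycle (h : IsCentralExtension p z) :
    liftedChains z →ₗ[ℤ] LinearMap.ker (bd ℤ E 2) where
  toFun x := ⟨shuffle z 2 x.1.1, h.totalCycle_mem x⟩
  map_add' x y := Subtype.ext (by
    simp only [Submodule.coe_add, Prod.fst_add, map_add])
  map_smul' c x := Subtype.ext (by
    simp only [Submodule.coe_smul, Prod.smul_fst, map_smul, RingHom.id_apply])

lemma IsCentralExtension.totalCycle_coe (h : IsCentralExtension p z) (x : liftedChains z) :
    (h.totalCycle x : Chain ℤ E 3) = shuffle z 2 x.1.1 := rfl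

lemma IsCentralExtension.baseCycle_surjective (h : IsCentralExtension p z) :
    Function.Surjective (homologyClass ℤ G 1 ∘ₗ h.baseCycle) := by
  intro σ
  obtain ⟨c, rfl⟩ := homologyClass_surjective ℤ G 1 σ
  obtain ⟨x, n, w, h1, h2⟩ := h.exists_lift_cycle c.1 c.2
  refine ⟨⟨(x, n), h1⟩, ?_⟩
  rw [LinearMap.comp_apply, ← sub_eq_zero, ← map_sub, homologyClass_eq_zero_iff]
  refine ⟨w, ?_⟩
  rw [Submodule.coe_sub, h.baseCycle_coe, h2]
  abel

lemma IsCentralExtension.gysin_wellDefined (h : IsCentralExtension p z) (x : liftedChains z)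
    (hx : (homologyClass ℤ G 1 ∘ₗ h.baseCycle) x = 0) :
    (homologyClass ℤ E 2 ∘ₗ h.totalCycle) x = 0 := by
  obtain ⟨w, hw⟩ := (homologyClass_eq_zero_iff ℤ G 1 _).1 hx
  exact (homologyClass_eq_zero_iff ℤ E 2 _).2 (h.shuffle_boundary x.1.1 x.1.2 x.2 w hw)

/-- The Gysin map `μ : H₂(BG; ℤ) → H₃(BE; ℤ)` of the circle bundle `BE → BG` belonging to a central
extension `0 → ℤ → E → G → 1`: it sends a cycle in the base to its preimage in the total space.
Every class in `H₂(BG; ℤ)` is represented by a cycle that lifts to `BE` away from discs, i.e. by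
`p_* x - n[1|1]` with `∂x = n[z]`. Over such a lift `x` the circle bundle is trivialised and its total
space is the cycle `[z] × x`, which closes up since `[z] × [z] = 0`. -/
def IsCentralExtension.gysin (h : IsCentralExtension p z) : H ℤ G 2 →ₗ[ℤ] H ℤ E 3 :=
  descend (homologyClass ℤ G 1 ∘ₗ h.baseCycle) h.baseCycle_surjective
    (homologyClass ℤ E 2 ∘ₗ h.totalCycle) h.gysin_wellDefined

lemma IsCentralExtension.gysin_apply (h : IsCentralExtension p z) (x : liftedChains z) :
    h.gysin (homologyClass ℤ G 1 (h.baseCycle x)) = homologyClass ℤ E 2 (h.totalCycle x) :=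
  descend_apply _ _ _ _ x

end Gysin

section Euler
variable {E G : Type} [Group E] [Group G] {p : E →* G} {z : E}

/-- The integer `n` with `s(a) s(b) = zⁿ s(ab)`, where `s` is the chosen section. -/
def IsCentralExtension.defect (h : IsCentralExtension p z) (a b : G) : ℤ :=
  (h.exists_zpow (a := h.sec a * h.sec b) (b := h.sec (a * b))
    (by simp only [map_mul, h.p_sec])).choose

lemma IsCentralExtension.sec_mul (h : IsCentralExtension p z) (a b : G) :
    h.sec a * h.sec b = z ^ h.defect a b * h.sec (a * b) :=
  (h.exists_zpow (a := h.sec a * h.sec b) (b := h.sec (a * b))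
    (by simp only [map_mul, h.p_sec])).choose_spec

lemma IsCentralExtension.defect_cocycle (h : IsCentralExtension p z) (a b c : G) :
    h.defect b c - h.defect (a * b) c + h.defect a (b * c) - h.defect a b = 0 := by
  have h1 : z ^ (h.defect a b + h.defect (a * b) c) * h.sec (a * b * c) =
      z ^ (h.defect b c + h.defect a (b * c)) * h.sec (a * b * c) := by
    calc _ = h.sec a * h.sec b * h.sec c := by
          rw [h.sec_mul, mul_assoc (z ^ _), h.sec_mul, ← mul_assoc, ← zpow_add]
      _ = h.sec a * (h.sec b * h.sec c) := mul_assoc _ _ _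
      _ = _ := by
          rw [h.sec_mul b c, ← mul_assoc, ← h.comm_zpow, mul_assoc, h.sec_mul, ← mul_assoc,
            ← zpow_add, mul_assoc a b c]
  have h2 := mul_right_cancel h1
  have h3 := h.infinite _ (by rw [zpow_sub, h2, mul_inv_cancel] :
    z ^ ((h.defect a b + h.defect (a * b) c) - (h.defect b c + h.defect a (b * c))) = 1)
  linarith

/-- The extension cocycle `(a, b) ↦ n`, `s(a) s(b) = zⁿ s(ab)`, with coefficients in `k`. -/
def IsCentralExtension.eulerCocycle (h : IsCentralExtension p z) (k : Type) [CommRing k] :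
    LinearMap.ker (cobd k G 2) :=
  ⟨fun x => (h.defect (x 0) (x 1) : k), by
    rw [LinearMap.mem_ker]
    funext x
    rw [vec_three x, cobd_two]
    exact_mod_cast congrArg (Int.cast : ℤ → k) (h.defect_cocycle (x 0) (x 1) (x 2))⟩

/-- The Euler class in `H²(BG; k)` of the circle bundle `BE → BG`: the class of the central extension
`0 → ℤ → E → G → 1`. -/
def IsCentralExtension.eulerClass (h : IsCentralExtension p z) (k : Type) [CommRing k] :
    Coh k G 2 := cohomologyClass k G 2 (h.eulerCocycle k)

end Euler

/-- `S¹ = ℝ / ℤ`. -/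
abbrev S1 : Type := AddCircle (1 : ℝ)

/-- In the local coordinates of `S¹` given by `ℝ → ℝ / ℤ`, the map `g` is real analytic with positive
derivative. -/
def IsAnalyticPositive (g : S1 → S1) : Prop :=
  ∀ x : ℝ, ∃ f : ℝ → ℝ, AnalyticAt ℝ f x ∧ 0 < deriv f x ∧ ∀ᶠ y : ℝ in 𝓝 x, g (y : S1) = (f y : S1)

lemma IsAnalyticPositive.comp {g h : S1 → S1} (hg : IsAnalyticPositive g)
    (hh : IsAnalyticPositive h) : IsAnalyticPositive (g ∘ h) := by
  intro x
  obtain ⟨f, hf, hf', hfe⟩ := hh x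
  obtain ⟨e, he, he', hee⟩ := hg (f x)
  refine ⟨e ∘ f, he.comp hf, ?_, ?_⟩
  · rw [deriv_comp x he.differentiableAt hf.differentiableAt]
    positivity
  · filter_upwards [hfe, hf.continuousAt.eventually hee] with y h1 h2
    simp [h1, h2]

/-- `Diff₊^ω S¹`: the group of orientation preserving real analytic diffeomorphisms of `S¹`. -/
def AnalyticDiffCircle : Subgroup (Equiv.Perm S1) where
  carrier := {g | IsAnalyticPositive g ∧ IsAnalyticPositive g.symm}
  mul_mem' {a b} ha hb := ⟨ha.1.comp hb.1, hb.2.comp ha.2⟩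
  one_mem' := by
    have : IsAnalyticPositive id := fun x => ⟨id, analyticAt_id, by simp, by simp⟩
    exact ⟨this, this⟩
  inv_mem' ha := ⟨ha.2, ha.1⟩

/-- The universal covering group of `Diff₊^ω S¹`: the orientation preserving real analytic
diffeomorphisms `f` of `ℝ` that commute with `T(x) = x + 1`. -/
def AnalyticDiffLine : Subgroup (Equiv.Perm ℝ) where
  carrier := {f | AnalyticOnNhd ℝ f Set.univ ∧ AnalyticOnNhd ℝ f.symm Set.univ ∧
    StrictMono f ∧ ∀ x, f (x + 1) = f x + 1}
  mul_mem' {a b} ha hb := ⟨fun x _ => (ha.1 _ trivial).comp (hb.1 x trivial),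
    fun x _ => (hb.2.1 _ trivial).comp (ha.2.1 x trivial), ha.2.2.1.comp hb.2.2.1,
    fun x => by simp [hb.2.2.2, ha.2.2.2]⟩
  one_mem' := ⟨analyticOnNhd_id, analyticOnNhd_id, strictMono_id, fun _ => rfl⟩
  inv_mem' {a} ha := ⟨ha.2.1, ha.1, fun x y h => by
      rw [← ha.2.2.1.lt_iff_lt]; simpa using h, fun x => a.injective (by
      rw [ha.2.2.2]; simp)⟩

instance : CoeFun AnalyticDiffLine (fun _ => ℝ → ℝ) := ⟨fun f => f.1⟩
instance : CoeFun AnalyticDiffCircle (fun _ => S1 → S1) := ⟨fun f => f.1⟩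

/-- `T(x) = x + 1`. -/
def translation : AnalyticDiffLine :=
  ⟨Equiv.addRight 1, fun x _ => analyticAt_id.add analyticAt_const,
    fun x _ => by simpa using! analyticAt_id.add analyticAt_const, fun x y h => by simpa using h,
    fun x => by simp⟩

lemma line_add_int (f : AnalyticDiffLine) (x : ℝ) (n : ℤ) : f (x + n) = f x + n := by
  have h1 : ∀ (f : AnalyticDiffLine) (x : ℝ) (n : ℕ), f (x + n) = f x + n := by
    intro f x n
    induction n with
    | zero => simp
    | succ n ih => push_cast; rw [← add_assoc, f.2.2.2.2, ih, add_assoc]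
  obtain ⟨n, rfl | rfl⟩ := n.eq_nat_or_neg
  · simpa using h1 f x n
  · have := h1 f (x + -n) n
    simp only [neg_add_cancel_right] at this
    push_cast; linarith

lemma coe_eq_iff (a b : ℝ) : (a : S1) = b ↔ ∃ n : ℤ, b = a + n := by
  rw [eq_comm, ← sub_eq_zero, ← AddCircle.coe_sub, AddCircle.coe_eq_zero_iff]
  exact exists_congr fun n => by rw [zsmul_one]; constructor <;> intro h <;> linarith

lemma exists_int_of_continuous (h : ℝ → ℝ) (hc : Continuous h) (hz : ∀ x, ∃ n : ℤ, h x = n) :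
    ∃ n : ℤ, ∀ x, h x = n := by
  choose n hn using hz
  have hcn : Continuous n := by
    rw [Int.isClosedEmbedding_coe_real.isEmbedding.continuous_iff]
    exact hc.congr hn
  refine ⟨n 0, fun x => ?_⟩
  rw [hn x, PreconnectedSpace.constant inferInstance hcn (x := x) (y := 0)]

/-- The self-map of `S¹ = ℝ / ℤ` induced by `f`. -/
def descendFun (f : AnalyticDiffLine) : S1 → S1 :=
  Function.Periodic.lift (f := fun x : ℝ => (f x : S1)) (c := 1) fun x => by
    simp only [f.2.2.2.2, AddCircle.coe_add, AddCircle.coe_period, add_zero]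

@[simp] lemma descendFun_coe (f : AnalyticDiffLine) (x : ℝ) :
    descendFun f (x : S1) = (f x : S1) := rfl

lemma descendFun_mul (f g : AnalyticDiffLine) (x : S1) :
    descendFun (f * g) x = descendFun f (descendFun g x) := by
  induction x using QuotientAddGroup.induction_on; rfl

lemma descendFun_one (x : S1) : descendFun 1 x = x := by
  induction x using QuotientAddGroup.induction_on; rfl

/-- The permutation of `S¹` induced by `f`. -/
def descendEquiv (f : AnalyticDiffLine) : Equiv.Perm S1 where
  toFun := descendFun f
  invFun := descendFun f⁻¹
  left_inv x := by rw [← descendFun_mul, inv_mul_cancel, descendFun_one]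
  right_inv x := by rw [← descendFun_mul, mul_inv_cancel, descendFun_one]

lemma deriv_pos (f : AnalyticDiffLine) (x : ℝ) : 0 < deriv f x := by
  have h1 : 0 ≤ deriv f x := f.2.2.2.1.monotone.deriv_nonneg
  refine lt_of_le_of_ne h1 fun h0 => ?_
  have hf : HasDerivAt f (deriv f x) x := (f.2.1 x trivial).differentiableAt.hasDerivAt
  have hg : HasDerivAt f.1.symm (deriv f.1.symm (f x)) (f x) :=
    (f.2.2.1 _ trivial).differentiableAt.hasDerivAt
  have := hg.comp x hf
  rw [← h0, mul_zero] at this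
  have h2 : HasDerivAt id (1 : ℝ) x := hasDerivAt_id x
  have h3 : f.1.symm ∘ f = id := by ext y; simp
  rw [h3] at this
  exact zero_ne_one (this.unique h2)



lemma descendFun_analytic (f : AnalyticDiffLine) : IsAnalyticPositive (descendFun f) :=
  fun x => ⟨f, f.2.1 x trivial, deriv_pos f x, by simp⟩

/-- The covering homomorphism `p` onto `Diff₊^ω S¹`. -/
def projection : AnalyticDiffLine →* AnalyticDiffCircle where
  toFun f := ⟨descendEquiv f, descendFun_analytic f, descendFun_analytic f⁻¹⟩
  map_one' := Subtype.ext (Equiv.ext descendFun_one)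
  map_mul' f g := Subtype.ext (Equiv.ext (descendFun_mul f g))

lemma projection_coe (f : AnalyticDiffLine) (x : ℝ) :
    projection f (x : S1) = (f x : S1) := rfl

lemma translation_mul_apply (f : AnalyticDiffLine) (x : ℝ) : (translation * f) x = f x + 1 := rfl

lemma translation_comm (f : AnalyticDiffLine) : translation * f = f * translation :=
  Subtype.ext (Equiv.ext fun x => (f.2.2.2.2 x).symm)

lemma translation_zpow_apply (n : ℤ) (x : ℝ) : (translation ^ n : AnalyticDiffLine) x = x + n := by
  have h1 : ∀ (n : ℕ) (x : ℝ), (translation ^ n : AnalyticDiffLine) x = x + n := by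
    intro n
    induction n with
    | zero => intro x; simp
    | succ n ih =>
      intro x
      rw [pow_succ', translation_mul_apply, ih]; push_cast; ring
  obtain ⟨n, rfl | rfl⟩ := n.eq_nat_or_neg
  · simpa using h1 n x
  · apply (translation ^ n : AnalyticDiffLine).1.injective
    have h2 : (translation ^ n : AnalyticDiffLine) ((translation ^ (-(n : ℤ)) : AnalyticDiffLine) x)
      = ((translation ^ n * translation ^ (-(n : ℤ)) : AnalyticDiffLine)) x := rfl
    rw [h2, h1, zpow_neg, zpow_natCast, mul_inv_cancel]
    push_cast
    simp

lemma ker_projection (f : AnalyticDiffLine) :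
    projection f = 1 ↔ ∃ n : ℤ, f = translation ^ n := by
  constructor
  · intro h
    have h1 : ∀ x : ℝ, ∃ n : ℤ, f x - x = n := fun x => by
      have h2 : ((x : ℝ) : S1) = (f x : S1) := by rw [← projection_coe, h]; rfl
      obtain ⟨n, hn⟩ := (coe_eq_iff _ _).1 h2
      exact ⟨n, by rw [hn]; ring⟩
    have hc : Continuous f := continuous_iff_continuousAt.2 fun x => (f.2.1 x trivial).continuousAt
    obtain ⟨n, hn⟩ := exists_int_of_continuous (fun x => f x - x) (hc.sub continuous_id) h1
    refine ⟨n, Subtype.ext (Equiv.ext fun x => ?_)⟩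
    rw [translation_zpow_apply, ← hn x]; ring
  · rintro ⟨n, rfl⟩
    refine Subtype.ext (Equiv.ext fun x => ?_)
    induction x using QuotientAddGroup.induction_on with | H x => ?_
    refine (projection_coe _ x).trans ?_
    rw [translation_zpow_apply]
    exact ((coe_eq_iff _ _).2 ⟨n, rfl⟩).symm

lemma IsAnalyticPositive.continuous {g : S1 → S1} (hg : IsAnalyticPositive g) :
    Continuous (fun x : ℝ => g (x : S1)) := by
  rw [continuous_iff_continuousAt]
  intro x
  obtain ⟨f, hf, -, he⟩ := hg x
  have : ContinuousAt (fun y : ℝ => (f y : S1)) x :=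
    (AddCircle.continuous_mk' 1).continuousAt.comp hf.continuousAt
  exact this.congr (he.mono fun _ h => h.symm)

lemma IsAnalyticPositive.exists_lift {g : S1 → S1} (hg : IsAnalyticPositive g) :
    ∃ F : ℝ → ℝ, AnalyticOnNhd ℝ F Set.univ ∧ StrictMono F ∧ ∀ x : ℝ, g (x : S1) = (F x : S1) := by
  obtain ⟨a, ha⟩ := QuotientAddGroup.mk_surjective (g ((0 : ℝ) : S1))
  obtain ⟨F, ⟨-, hF⟩, -⟩ := (AddCircle.isCoveringMap_coe (1 : ℝ)).existsUnique_continuousMap_lifts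
    ⟨_, hg.continuous⟩ 0 a ha
  have hF' : ∀ x : ℝ, g (x : S1) = (F x : S1) := fun x => (congrFun hF x).symm
  have key : ∀ x, AnalyticAt ℝ F x ∧ 0 < deriv F x := by
    intro x
    obtain ⟨f, hf, hf', he⟩ := hg x
    obtain ⟨n, hn⟩ := (coe_eq_iff (f x) (F x)).1 (by rw [← hF', he.self_of_nhds])
    have hc : ContinuousAt (fun y => F y - f y) x :=
      F.continuous.continuousAt.sub hf.continuousAt
    have h1 : ∀ᶠ y in 𝓝 x, |(F y - f y) - n| < 1 := by
      have := hc.eventually (Metric.ball_mem_nhds _ one_pos)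
      filter_upwards [this] with y hy
      change dist (F y - f y) (F x - f x) < 1 at hy
      rw [Real.dist_eq] at hy
      rwa [show F x - f x = n by rw [hn]; ring] at hy
    have h2 : F =ᶠ[𝓝 x] fun y => f y + n := by
      filter_upwards [h1, he] with y h1 h2
      obtain ⟨m, hm⟩ := (coe_eq_iff (f y) (F y)).1 (by rw [← hF', h2])
      have h3 : |((m - n : ℤ) : ℝ)| < 1 := by
        push_cast; convert h1 using 2; rw [hm]; ring
      have h4 : m - n = 0 := by
        rw [← Int.abs_lt_one_iff]; exact_mod_cast h3
      rw [hm, show m = n by omega]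
    refine ⟨(hf.add analyticAt_const).congr h2.symm, ?_⟩
    rw [h2.deriv_eq, deriv_add_const]
    exact hf'
  exact ⟨F, fun x _ => (key x).1, strictMono_of_deriv_pos fun x => (key x).2, hF'⟩

lemma projection_surjective : Function.Surjective projection := by
  intro g
  obtain ⟨F, hFa, hFm, hF⟩ := g.2.1.exists_lift
  obtain ⟨E, hEa, hEm, hE⟩ := g.2.2.exists_lift
  have cont : ∀ {f : ℝ → ℝ}, AnalyticOnNhd ℝ f Set.univ → Continuous f := fun h =>
    continuous_iff_continuousAt.2 fun x => (h x trivial).continuousAt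
  have hFc := cont hFa
  have hEc := cont hEa
  obtain ⟨n, hn⟩ := exists_int_of_continuous (fun x => E (F x) - x)
    ((hEc.comp hFc).sub continuous_id) (fun x => by
      obtain ⟨n, hn⟩ := (coe_eq_iff x (E (F x))).1 (by rw [← hE, ← hF]; simp)
      exact ⟨n, by rw [hn]; ring⟩)
  obtain ⟨d, hd⟩ := exists_int_of_continuous (fun x => F (x + 1) - F x)
    ((hFc.comp (continuous_id.add continuous_const)).sub hFc) (fun x => by
      obtain ⟨n, hn⟩ := (coe_eq_iff (F x) (F (x + 1))).1 (by rw [← hF, ← hF]; simp)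
      exact ⟨n, by rw [hn]; ring⟩)
  obtain ⟨e, he⟩ := exists_int_of_continuous (fun x => E (x + 1) - E x)
    ((hEc.comp (continuous_id.add continuous_const)).sub hEc) (fun x => by
      obtain ⟨n, hn⟩ := (coe_eq_iff (E x) (E (x + 1))).1 (by rw [← hE, ← hE]; simp)
      exact ⟨n, by rw [hn]; ring⟩)
  obtain ⟨m, hm⟩ := exists_int_of_continuous (fun x => F (E x) - x)
    ((hFc.comp hEc).sub continuous_id) (fun x => by
      obtain ⟨n, hn⟩ := (coe_eq_iff x (F (E x))).1 (by rw [← hF, ← hE]; simp)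
      exact ⟨n, by rw [hn]; ring⟩)
  have hEF : ∀ x, E (F x) - n = x := fun x => by linarith [hn x]
  have hFE : ∀ x, F (E x - n) = x := fun x => by
    apply hEm.injective
    linarith [hEF (E x - n)]
  have hE1 : ∀ (y : ℝ) (k : ℕ), E (y + k) = E y + k * e := by
    intro y k
    induction k with
    | zero => simp
    | succ k ih => push_cast; rw [← add_assoc]; linarith [he (y + k)]
  have hdpos : 0 < d := by
    have := hFm (show (0 : ℝ) < 0 + 1 by norm_num)
    have h2 := hd 0
    exact_mod_cast (by linarith : (0 : ℝ) < d)
  have hd1 : d = 1 := by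
    have h1 := hE1 (F 0) d.toNat
    have h2 : F 0 + (d.toNat : ℝ) = F (0 + 1) := by
      have : ((d.toNat : ℤ) : ℝ) = d := by rw [Int.toNat_of_nonneg hdpos.le]
      rw [← Int.cast_natCast, this]; linarith [hd 0]
    rw [h2] at h1
    have h3 := hEF 0
    have h4 := hEF (0 + 1)
    have h5 : ((d.toNat : ℤ) * e : ℤ) = 1 := by
      have : ((d.toNat : ℝ) * e) = 1 := by linarith
      exact_mod_cast this
    rw [Int.toNat_of_nonneg hdpos.le] at h5
    rcases Int.eq_one_or_neg_one_of_mul_eq_one h5 with h | h <;> omega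
  let f : Equiv.Perm ℝ := ⟨F, fun y => E y - n, hEF, hFE⟩
  refine ⟨⟨f, hFa, fun x _ => (hEa x trivial).sub analyticAt_const, hFm, fun x => ?_⟩, ?_⟩
  · have := hd x
    rw [hd1] at this
    change F (x + 1) = F x + 1
    push_cast at this; linarith
  · refine Subtype.ext (Equiv.ext fun x => ?_)
    induction x using QuotientAddGroup.induction_on with | H x => ?_
    exact (hF x).symm

/-- The endomorphism `φ_k(f)(x) = f(kx) / k`, for `k = 2, 3, …`. -/
def scaling (k : ℕ) (hk : 2 ≤ k) : AnalyticDiffLine →* AnalyticDiffLine where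
  toFun f := ⟨⟨fun x => f (k * x) / k, fun x => f.1.symm (k * x) / k, fun x => by
      have : (k : ℝ) ≠ 0 := by positivity
      field_simp; simp, fun x => by
      have : (k : ℝ) ≠ 0 := by positivity
      field_simp; simp⟩, fun x _ => by
        exact ((f.2.1 _ trivial).comp (f := fun x => (k : ℝ) * x)
          (analyticAt_const.mul analyticAt_id)).div_const,
      fun x _ => by
        exact ((f.2.2.1 _ trivial).comp (f := fun x => (k : ℝ) * x)
          (analyticAt_const.mul analyticAt_id)).div_const,
      fun x y h => by
        have hk0 : (0 : ℝ) < k := by positivity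
        exact div_lt_div_of_pos_right (f.2.2.2.1 (by gcongr)) hk0, fun x => by
        have hk0 : (0 : ℝ) < k := by positivity
        have := line_add_int f (k * x) k
        change f (k * (x + 1)) / k = f (k * x) / k + 1
        rw [mul_add, mul_one]
        push_cast at this
        rw [this]; field_simp⟩
  map_one' := Subtype.ext (Equiv.ext fun x => by
    have hk0 : (k : ℝ) ≠ 0 := by positivity
    change (k * x) / k = x
    field_simp)
  map_mul' f g := Subtype.ext (Equiv.ext fun x => by
    have hk0 : (k : ℝ) ≠ 0 := by positivity
    change f (g (k * x)) / k = f (k * (g (k * x) / k)) / k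
    congr 2; field_simp)

lemma scaling_apply (k : ℕ) (hk : 2 ≤ k) (f : AnalyticDiffLine) (x : ℝ) :
    scaling k hk f x = (1 / k) * f (k * x) := by
  change f (k * x) / k = _
  ring


/-- `0 → ℤ → E → Diff₊^ω S¹ → 1`, with `E` the universal covering group and `ℤ` generated by `T`, is
a central extension. -/
lemma isCentralExtension_projection : IsCentralExtension projection translation where
  surjective := projection_surjective
  central := translation_comm
  ker := ker_projection
  infinite n hn := by
    have h : (translation ^ n : AnalyticDiffLine) (0 : ℝ) = (1 : AnalyticDiffLine) (0 : ℝ) := by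
      rw [hn]
    rw [translation_zpow_apply] at h
    have h2 : (0 : ℝ) + n = 0 := h
    exact_mod_cast (by linarith : (n : ℝ) = 0)

/-- The Euler class `χ ∈ H²(BDiff₊^{ω,δ} S¹; k)`. -/
def chi (k : Type) [CommRing k] : Coh k AnalyticDiffCircle 2 :=
  isCentralExtension_projection.eulerClass k

/-- The Gysin map `μ : H₂(BDiff₊^{ω,δ} S¹; ℤ) → H₃(BE; ℤ)`, where `E` is the universal covering group
of `Diff₊^ω S¹` with the discrete topology. -/
def mu : H ℤ AnalyticDiffCircle 2 →ₗ[ℤ] H ℤ AnalyticDiffLine 3 :=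
  isCentralExtension_projection.gysin

end FlatCircle
end

/-! Assume $\chi^2=0$ rationally. Let $\eta:\widetilde G\to\mathbb{R}$ be evaluation at $0$, so that
$\eta(T^i g)=i+\eta(g)$, and put $D(a,b)=\eta(ab)-\eta(a)-\eta(b)$. Then $D=-\delta\eta$ comes from
a cocycle on $G$ representing the real Euler class. Since $\chi^2=0$, there is a real cochain
$\alpha$ on $G$ whose pullback satisfies $\delta\alpha=D\cup D$
(`IsCentralExtension.exists_primitive`). Hence $\theta=\eta\cup D+\alpha$ is a closed $3$-cochain on
$\widetilde G$ (`cobd_transgression`), whose integral along the fibre is, up to sign, the Euler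
class.

Represent $\sigma$ by a chain $x$ on $\widetilde G$ with $\partial x=n[T]$, so that $\mu(\sigma)$ is
the class of $[T]\times x$. The claim is that $\theta$ takes the value $-n$ on it, whereas
$\varphi_k^*\theta$ takes the value $-n/k^2$. One factor $1/k$ comes from
$\eta\circ\varphi_k=\eta/k$ and the other from the corresponding scaling of $D$. If
$(\varphi_k)_*\mu(\sigma)=\mu(\sigma)$, the two values agree, so $n=0$. But then $\chi(\sigma)=0$
(`IsCentralExtension.pairing_eq_zero`), a contradiction.

The subtle point is $\alpha\circ\varphi_k$: since $\varphi_k(T)$ is translation by $1/k$, this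
cochain does not obviously descend to $G$. However $\varphi_k(T^k)=T$, so it has period $T^k$.
`evalReal_transgression` treats both evaluations at once, with period $z^m$ for $m=1$ and $m=k$. The
cycle $m\,[z]\times x$ is replaced by $[z^m]\times x$, on which $\alpha$ contributes nothing beyond
its value on $[1]\times x$. The correction terms form $n$ times the fundamental $3$-cycle of
$\mathbb{Z}/m$, and a real cocycle vanishes on it (`sum_cyclic_eq_zero`). -/

namespace FlatCircle

/-! ### Induced maps on homology in terms of explicit bar cycles. -/

section Naturality

section Generic

variable {k : Type} [CommRing k] {ι : Type} {c : ComplexShape ι}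
  {K L : HomologicalComplex (ModuleCat.{0} k) c} (F : K ⟶ L) (j l : ι)

lemma map_mem_ker_d (x : LinearMap.ker (K.d j l).hom) :
    (F.f j).hom x.1 ∈ LinearMap.ker (L.d j l).hom := by
  have h : (L.d j l).hom ((F.f j).hom x.1) = (F.f l).hom ((K.d j l).hom x.1) :=
    congrArg (fun φ : K.X j ⟶ L.X l => φ.hom x.1) (F.comm j l)
  rw [LinearMap.mem_ker, h, LinearMap.mem_ker.1 x.2, map_zero]

/-- Since `iCycles` is a monomorphism, it suffices to compare the two cycles as elements of `L.X j`,
where naturality of `iCycles` identifies them. -/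
lemma homologyMap_classMap (hl : c.next j = l) (x : LinearMap.ker (K.d j l).hom) :
    (HomologicalComplex.homologyMap F j).hom (classMap K j l hl x) =
      classMap L j l hl ⟨(F.f j).hom x.1, map_mem_ker_d F j l x⟩ := by
  have h1 : ∀ y, (HomologicalComplex.homologyMap F j).hom ((K.homologyπ j).hom y) =
      (L.homologyπ j).hom ((HomologicalComplex.cyclesMap F j).hom y) := fun y =>
    congrArg (fun φ : K.cycles j ⟶ L.homology j => φ.hom y)
      (HomologicalComplex.homologyπ_naturality F j)
  have h2 : ∀ y, (L.iCycles j).hom ((HomologicalComplex.cyclesMap F j).hom y) =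
      (F.f j).hom ((K.iCycles j).hom y) := fun y =>
    congrArg (fun φ : K.cycles j ⟶ L.X j => φ.hom y) (HomologicalComplex.cyclesMap_i F j)
  refine (h1 _).trans (congrArg (L.homologyπ j).hom ?_)
  apply (ModuleCat.mono_iff_injective (L.iCycles j)).1 inferInstance
  refine (h2 _).trans (Eq.trans ?_ (classMap_aux L j l hl _).symm)
  exact congrArg (F.f j).hom (classMap_aux K j l hl x)

end Generic

variable {k : Type} [CommRing k] {Γ Δ : Type} [Group Γ] [Group Δ]

/-- The chain map on inhomogeneous chains induced by a group homomorphism. -/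
noncomputable abbrev trivialChainsMap (k : Type) [CommRing k] (f : Γ →* Δ) :
    groupHomology.inhomogeneousChains (Rep.trivial k Γ k) ⟶
      groupHomology.inhomogeneousChains (Rep.trivial k Δ k) :=
  groupHomology.chainsMap (A := Rep.trivial k Γ k) (B := Rep.trivial k Δ k) f
    (𝟙 _ : Rep.trivial k Γ k ⟶ Rep.res f (Rep.trivial k Δ k))

lemma trivialChainsMap_f_hom (f : Γ →* Δ) (n : ℕ) :
    (((trivialChainsMap k f).f n).hom : Chain k Γ n →ₗ[k] Chain k Δ n) = push k f n := by
  refine Finsupp.lhom_ext fun g t => ?_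
  refine (groupHomology.chainsMap_f_single (A := Rep.trivial k Γ k) (B := Rep.trivial k Δ k) f
    (𝟙 _ : Rep.trivial k Γ k ⟶ Rep.res f (Rep.trivial k Δ k)) n g t).trans ?_
  exact (push_single k f n g t).symm

lemma push_mem_ker_bd (f : Γ →* Δ) (n : ℕ) (c : LinearMap.ker (bd k Γ n)) :
    push k f (n + 1) c.1 ∈ LinearMap.ker (bd k Δ n) := by
  rw [LinearMap.mem_ker, bd_push, LinearMap.mem_ker.1 c.2, map_zero]

/-- This turns the hypothesis on $(\varphi_k)_*\mu(\sigma)$ into a statement about explicit cycles,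
on which cochains can be evaluated. -/
lemma homologyMap_homologyClass (f : Γ →* Δ) (n : ℕ) (c : LinearMap.ker (bd k Γ n)) :
    homologyMap k f (n + 1) (homologyClass k Γ n c) =
      homologyClass k Δ n ⟨push k f (n + 1) c.1, push_mem_ker_bd f n c⟩ := by
  refine (homologyMap_classMap (trivialChainsMap k f) (n + 1) n
    (ChainComplex.next_nat_succ n) c).trans ?_
  exact congrArg (homologyClass k Δ n)
    (Subtype.ext (LinearMap.congr_fun (trivialChainsMap_f_hom f (n + 1)) c.1))

end Naturality

/-! ### Pairing real cochains with integral chains. -/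

section RealEvaluation

variable {E G : Type} [Group E] [Group G]

/-- Evaluation of a real cochain on an integral chain. -/
noncomputable def evalReal {n : ℕ} (f : Cochain ℝ E n) : Chain ℤ E n →ₗ[ℤ] ℝ :=
  Finsupp.linearCombination ℤ f

@[simp] lemma evalReal_single {n : ℕ} (f : Cochain ℝ E n) (g : Fin n → E) (t : ℤ) :
    evalReal f (Finsupp.single g t) = t * f g := by
  simp [evalReal]

/-- Stokes' formula across coefficients: a closed real cochain vanishes on boundaries of integral
chains, so it detects classes in integral homology. -/
lemma evalReal_bd {n : ℕ} (f : Cochain ℝ E n) (x : Chain ℤ E (n + 1)) :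
    evalReal f (bd ℤ E n x) = evalReal (cobd ℝ E n f) x := by
  induction x using Finsupp.induction_linear with
  | zero => simp
  | add x y hx hy => simp only [map_add, hx, hy]
  | single g t =>
    rw [bd_single, evalReal_single, cobd_apply]
    simp only [map_add, map_sum, map_smul, evalReal_single, mul_add, Finset.mul_sum]
    congr 1
    refine Finset.sum_congr rfl fun j _ => ?_
    rw [zsmul_eq_mul]
    push_cast
    ring

lemma evalReal_push (p : E →* G) {n : ℕ} (f : Cochain ℝ G n) (x : Chain ℤ E n) :
    evalReal f (push ℤ p n x) = evalReal (fun g : Fin n → E => f fun i => p (g i)) x := by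
  induction x using Finsupp.induction_linear with
  | zero => simp
  | add x y hx hy => simp only [map_add, hx, hy]
  | single g t => rw [push, push_single, evalReal_single, evalReal_single]

end RealEvaluation

/-! ### Additivity of $z\mapsto[z]\times x$ up to boundaries. -/

section DoubleShuffle

variable {E : Type} [Group E]

/-- The shuffle product with the bar symbol `[u|v]`, on `1`-chains. -/
noncomputable def doubleShuffleOne (u v : E) : Chain ℤ E 1 →ₗ[ℤ] Chain ℤ E 3 :=
  Finsupp.lsum ℤ fun g => Finsupp.lsingle ![u, v, g 0] - Finsupp.lsingle ![u, g 0, v]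
    + Finsupp.lsingle ![g 0, u, v]

/-- The shuffle product with the bar symbol `[u|v]`, on `2`-chains. -/
noncomputable def doubleShuffleTwo (u v : E) : Chain ℤ E 2 →ₗ[ℤ] Chain ℤ E 4 :=
  Finsupp.lsum ℤ fun g => Finsupp.lsingle ![u, v, g 0, g 1] - Finsupp.lsingle ![u, g 0, v, g 1]
    + Finsupp.lsingle ![u, g 0, g 1, v] + Finsupp.lsingle ![g 0, u, v, g 1]
    - Finsupp.lsingle ![g 0, u, g 1, v] + Finsupp.lsingle ![g 0, g 1, u, v]

lemma doubleShuffleOne_single (u v a : E) (t : ℤ) :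
    doubleShuffleOne u v (Finsupp.single ![a] t) = Finsupp.single ![u, v, a] t
      - Finsupp.single ![u, a, v] t + Finsupp.single ![a, u, v] t := by
  simp [doubleShuffleOne]

lemma doubleShuffleTwo_single (u v a b : E) (t : ℤ) :
    doubleShuffleTwo u v (Finsupp.single ![a, b] t) = Finsupp.single ![u, v, a, b] t
      - Finsupp.single ![u, a, v, b] t + Finsupp.single ![u, a, b, v] t
      + Finsupp.single ![a, u, v, b] t - Finsupp.single ![a, u, b, v] t
      + Finsupp.single ![a, b, u, v] t := by
  simp [doubleShuffleTwo]

/-- The Leibniz rule $\partial([u|v]\times x)=\partial[u|v]\times x+[u|v]\times\partial x$ with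
$\partial[u|v]=[v]-[uv]+[u]$. Centrality of `u` and `v` makes the faces that multiply `u` or `v`
with an entry of `x` cancel in pairs. -/
lemma bd_doubleShuffleTwo {u v : E} (hu : ∀ x, u * x = x * u) (hv : ∀ x, v * x = x * v)
    (x : Chain ℤ E 2) :
    bd ℤ E 3 (doubleShuffleTwo u v x) = shuffle v 2 x - shuffle (u * v) 2 x + shuffle u 2 x
      + doubleShuffleOne u v (bd ℤ E 1 x) := by
  induction x using chain_two_induction with
  | h0 => simp
  | hadd x y hx hy => simp only [map_add, hx, hy]; abel
  | hs a b t =>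
    simp only [doubleShuffleTwo_single, map_add, map_sub, bd_three, bd_one,
      doubleShuffleOne_single, shuffle_two, hu a, hu b, hv a, hv b]
    abel

end DoubleShuffle

/-! ### The closed cochain $\theta=\eta\cup D+\alpha$ and its value on $[z]\times x$. -/

section Evaluation

variable {E : Type} [Group E]

/-- The real `3`-cochain `η ∪ D + α`, with `D(a, b) = η(ab) - η(a) - η(b)`. -/
def transgression (η : E → ℝ) (α : E → E → E → ℝ) : Cochain ℝ E 3 := fun x =>
  η (x 0) * (η (x 1 * x 2) - η (x 1) - η (x 2)) + α (x 0) (x 1) (x 2)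

lemma transgression_apply (η : E → ℝ) (α : E → E → E → ℝ) (a b c : E) :
    transgression η α ![a, b, c] = η a * (η (b * c) - η b - η c) + α a b c := rfl

/-- Since $\delta\eta=-D$ and $\delta D=0$, one has $\delta(\eta\cup D)=-D\cup D$, which
$\delta\alpha=D\cup D$ cancels. -/
lemma cobd_transgression {η : E → ℝ} {α : E → E → E → ℝ}
    (hα : ∀ a b c e, α b c e - α (a * b) c e + α a (b * c) e - α a b (c * e) + α a b c =
      (η (a * b) - η a - η b) * (η (c * e) - η c - η e)) :
    cobd ℝ E 3 (transgression η α) = 0 := by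
  funext x
  rw [vec_four x]
  generalize x 0 = a, x 1 = b, x 2 = c, x 3 = e
  rw [cobd_three]
  simp only [transgression_apply, Pi.zero_apply, mul_assoc]
  linear_combination hα a b c e

lemma sum_range_shift {f : ℕ → ℝ} {m : ℕ} (h : f m = f 0) :
    ∑ i ∈ Finset.range m, f (i + 1) = ∑ i ∈ Finset.range m, f i := by
  have := Finset.sum_range_succ f m
  rw [Finset.sum_range_succ'] at this
  linarith

/-- A `3`-cochain of a group that is closed and periodic on a cyclic subgroup vanishes on the
fundamental cycle of the corresponding finite cyclic group. -/
lemma sum_cyclic_eq_zero {α : E → E → E → ℝ} {z : E} {m : ℕ} (hm : 0 < m)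
    (h1 : ∀ a b, α (z ^ m) a b = α 1 a b) (h2 : ∀ a b, α a (z ^ m) b = α a 1 b)
    (h3 : ∀ a b, α a b (z ^ m) = α a b 1)
    (hα : ∀ i j : ℕ, α z (z ^ j) z - α (z ^ (i + 1)) (z ^ j) z + α (z ^ i) (z ^ (j + 1)) z
      - α (z ^ i) z (z ^ (j + 1)) + α (z ^ i) z (z ^ j) = 0) :
    ∑ j ∈ Finset.range m, α z (z ^ j) z = 0 := by
  -- Sum the cocycle identity at $(z^i,z,z^j,z)$ over all $i,j<m$. Periodicity makes the last four
  -- terms cancel in pairs, and the first gives $m$ times the desired sum: this is why $m$ kills the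
  -- fundamental class.
  have key : ∑ i ∈ Finset.range m, ∑ j ∈ Finset.range m,
      (α z (z ^ j) z - α (z ^ (i + 1)) (z ^ j) z + α (z ^ i) (z ^ (j + 1)) z
      - α (z ^ i) z (z ^ (j + 1)) + α (z ^ i) z (z ^ j)) = 0 :=
    Finset.sum_eq_zero fun i _ => Finset.sum_eq_zero fun j _ => hα i j
  simp only [Finset.sum_add_distrib, Finset.sum_sub_distrib] at key
  have e1 : ∑ i ∈ Finset.range m, ∑ j ∈ Finset.range m, α (z ^ (i + 1)) (z ^ j) z =
      ∑ i ∈ Finset.range m, ∑ j ∈ Finset.range m, α (z ^ i) (z ^ j) z :=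
    sum_range_shift (f := fun i => ∑ j ∈ Finset.range m, α (z ^ i) (z ^ j) z)
      (by simp only [h1, pow_zero])
  have e2 : ∀ i, ∑ j ∈ Finset.range m, α (z ^ i) (z ^ (j + 1)) z =
      ∑ j ∈ Finset.range m, α (z ^ i) (z ^ j) z := fun i =>
    sum_range_shift (f := fun j => α (z ^ i) (z ^ j) z) (by simp only [h2, pow_zero])
  have e3 : ∀ i, ∑ j ∈ Finset.range m, α (z ^ i) z (z ^ (j + 1)) =
      ∑ j ∈ Finset.range m, α (z ^ i) z (z ^ j) := fun i =>
    sum_range_shift (f := fun j => α (z ^ i) z (z ^ j)) (by simp only [h3, pow_zero])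
  simp only [e1, e2, e3, Finset.sum_const, Finset.card_range, nsmul_eq_mul] at key
  have hm' : (m : ℝ) ≠ 0 := by positivity
  refine (mul_eq_zero.1 (?_ : (m : ℝ) * _ = 0)).resolve_left hm'
  linarith

/-- Induction on `m`, with `bd_doubleShuffleTwo` for $u=z$, $v=z^m$. As $\partial x=n[z]$, the
correction is $n$ times the shuffle of $[z|z^m]$ with $[z]$, in which two of the three terms cancel
and $[z|z^m|z]$ remains. The term `shuffle 1 2 x` has to be kept because the bar complex is not
normalised. -/
lemma evalReal_shuffle_pow {z : E} (hz : ∀ x, z * x = x * z) {θ : Cochain ℝ E 3}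
    (hθ : cobd ℝ E 3 θ = 0) {x : Chain ℤ E 2} {n : ℤ}
    (hx : bd ℤ E 1 x = n • Finsupp.single ![z] 1) (m : ℕ) :
    evalReal θ (shuffle (z ^ m) 2 x) = evalReal θ (shuffle 1 2 x)
      + m * evalReal θ (shuffle z 2 x) + n * ∑ j ∈ Finset.range m, θ ![z, z ^ j, z] := by
  induction m with
  | zero => simp
  | succ m ih =>
    have hzm : ∀ x, z ^ m * x = x * z ^ m := fun x =>
      ((show Commute z x from hz x).pow_left m).eq
    have h := congrArg (evalReal θ) (bd_doubleShuffleTwo hz hzm x)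
    rw [evalReal_bd, hθ, hx, map_smul, doubleShuffleOne_single] at h
    simp only [map_add, map_sub, map_smul, evalReal_single, ← pow_succ', zsmul_eq_mul] at h
    have h0 : evalReal (0 : Cochain ℝ E 4) (doubleShuffleTwo z (z ^ m) x) = 0 := by
      simp [evalReal]
    rw [h0] at h
    rw [Finset.sum_range_succ]
    push_cast at h ⊢
    linear_combination ih + h

/-- Comparing $[z^m]\times x$ with $[1]\times x$ gives $m\,\theta([z]\times x)=-n\,\eta(z)$, and
$\eta(z)=1/m$ supplies the second factor. No descent of $\alpha$ to the quotient by $z^m$ is needed,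
only that an entry equal to $z^m$ can be replaced by $1$. -/
lemma evalReal_transgression {z : E} (hz : ∀ x, z * x = x * z) {m : ℕ} (hm : 0 < m) {η : E → ℝ}
    (hη1 : η 1 = 0) (hη : ∀ (i : ℕ) g, η (z ^ i * g) = i / m + η g) {α : E → E → E → ℝ}
    (h1 : ∀ a b, α (z ^ m) a b = α 1 a b) (h2 : ∀ a b, α a (z ^ m) b = α a 1 b)
    (h3 : ∀ a b, α a b (z ^ m) = α a b 1)
    (hα : ∀ a b c e, α b c e - α (a * b) c e + α a (b * c) e - α a b (c * e) + α a b c =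
      (η (a * b) - η a - η b) * (η (c * e) - η c - η e))
    {x : Chain ℤ E 2} {n : ℤ} (hx : bd ℤ E 1 x = n • Finsupp.single ![z] 1) :
    (m : ℝ) ^ 2 * evalReal (transgression η α) (shuffle z 2 x) = -n := by
  have hm' : (m : ℝ) ≠ 0 := by positivity
  have hηz : ∀ i : ℕ, η (z ^ i) = i / m := fun i => by simpa [hη1] using hη i 1
  have hηz1 : η z = 1 / m := by simpa using hηz 1
  have hηr : ∀ (i : ℕ) g, η (g * z ^ i) = i / m + η g := fun i g => by
    rw [← ((show Commute z g from hz g).pow_left i).eq, hη]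
  -- On powers of `z` the function $\eta$ is additive, so $D$ vanishes there, $\theta$ reduces to
  -- $\alpha$, and $\alpha$ is closed.
  have hsum : ∑ j ∈ Finset.range m, transgression η α ![z, z ^ j, z] = 0 := by
    refine Eq.trans (Finset.sum_congr rfl fun j _ => ?_) (sum_cyclic_eq_zero hm h1 h2 h3 ?_)
    · rw [transgression_apply, hη]; simp [hηz]
    · intro i j
      have := hα (z ^ i) z (z ^ j) z
      rw [← pow_succ, ← pow_succ, ← pow_succ'] at this
      simp only [hηz, hηz1] at this
      push_cast at this
      linear_combination this
  -- The $\alpha$ terms cancel by periodicity, and $D$ vanishes as soon as one entry is $z^m$ or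
  -- $1$. With $\eta(z^m)=1$ and $\eta(1)=0$, only $D(a,b)=-\delta\eta(a,b)$ survives.
  have hdiff : ∀ y : Chain ℤ E 2, evalReal (transgression η α) (shuffle (z ^ m) 2 y)
      - evalReal (transgression η α) (shuffle 1 2 y)
        = - evalReal (fun g => η (g 0) : Cochain ℝ E 1) (bd ℤ E 1 y) := by
    intro y
    induction y using chain_two_induction with
    | h0 => simp
    | hadd x y hx hy => simp only [map_add]; linear_combination hx + hy
    | hs a b t =>
      simp only [shuffle_two, bd_one, map_add, map_sub, evalReal_single, transgression_apply,
        h1, h2, h3, hηr, hη, hηz, hη1, one_mul, mul_one, Matrix.cons_val_zero]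
      field_simp
      ring
  have h := evalReal_shuffle_pow hz (cobd_transgression hα) hx m
  rw [hsum] at h
  have hd := hdiff x
  rw [hx, map_smul, evalReal_single] at hd
  simp only [Matrix.cons_val_zero, hηz1, zsmul_eq_mul] at hd
  have h' : (m : ℝ) * evalReal (transgression η α) (shuffle z 2 x) = - (n * (1 / m)) := by
    push_cast at hd
    linear_combination hd - h
  rw [sq, mul_assoc, h']
  field_simp

end Evaluation

/-! ### The Euler cocycle pulled back to the total group, and a primitive of its square. -/

section CentralExtension

variable {E G : Type} [Group E] [Group G] {p : E →* G} {z : E}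

/-- Write $g=z^{\xi(g)}s(p(g))$ and compare exponents in the two expressions for $ab$, using that
`z` is central of infinite order. Thus the extension cocycle becomes $-\delta\xi$ on `E`. -/
lemma IsCentralExtension.exists_coordinate (h : IsCentralExtension p z) :
    ∃ ξ : E → ℤ, (∀ g, g = z ^ ξ g * h.sec (p g)) ∧
      ∀ a b, h.defect (p a) (p b) = ξ (a * b) - ξ a - ξ b := by
  choose ξ hξ using fun g : E => h.exists_zpow (h.p_sec (p g)).symm
  refine ⟨ξ, hξ, fun a b => ?_⟩
  have e1 : z ^ ξ (a * b) * h.sec (p a * p b) =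
      z ^ (ξ a + ξ b + h.defect (p a) (p b)) * h.sec (p a * p b) := by
    rw [← map_mul, ← hξ (a * b), map_mul, zpow_add, mul_assoc, ← h.sec_mul, zpow_add, mul_assoc,
      ← mul_assoc (z ^ ξ b), h.comm_zpow (ξ b), mul_assoc, ← hξ b, ← mul_assoc, ← hξ a]
  have e2 := mul_right_cancel e1
  have e3 := h.infinite (ξ (a * b) - (ξ a + ξ b + h.defect (p a) (p b)))
    (by rw [zpow_sub, e2, mul_inv_cancel])
  linarith

/-- When $n=0$ the base cycle is $p_*x$ with $\partial x=0$, and the pullback of the Euler cocycle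
to `E` is the coboundary $-\delta\xi$. -/
lemma IsCentralExtension.pairing_eq_zero (h : IsCentralExtension p z) (x : liftedChains z)
    (hx : x.1.2 = 0) :
    pairing 1 (h.eulerClass ℤ) (homologyClass ℤ G 1 (h.baseCycle x)) = 0 := by
  obtain ⟨ξ, -, hξ⟩ := h.exists_coordinate
  rw [eulerClass, pairing_class, h.baseCycle_coe, hx, zero_smul, sub_zero]
  have key : ∀ y : Chain ℤ E 2, evalChain 2 (h.eulerCocycle ℤ).1 (push ℤ p 2 y) =
      - evalChain 1 (fun g => ξ (g 0) : Cochain ℤ E 1) (bd ℤ E 1 y) := by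
    intro y
    induction y using chain_two_induction with
    | h0 => simp
    | hadd x y hx hy => simp only [map_add, hx, hy]; abel
    | hs a b t =>
      rw [push_two, bd_one]
      simp only [map_add, map_sub, evalChain_single, eulerCocycle, Matrix.cons_val_zero,
        Matrix.cons_val_one, hξ, Int.cast_id]
      ring
  refine (key _).trans ?_
  rw [(mem_liftedChains z x.1).1 x.2, hx, zero_smul, map_zero, neg_zero]

/-- The hypothesis gives a primitive `w` for the square of the integral extension cocycle $c$,
whereas $D\cup D$ is needed. Since $\eta-\xi$ factors through `G`, the cocycles $D$ and $c$ differ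
by a coboundary on `G`, and `w` can be corrected there. -/
lemma IsCentralExtension.exists_primitive (h : IsCentralExtension p z)
    (hcup : cup (h.eulerClass ℚ) (h.eulerClass ℚ) = 0) (η : E → ℝ)
    (hη : ∀ (i : ℤ) g, η (z ^ i * g) = i + η g) :
    ∃ α : G → G → G → ℝ, ∀ a b c e : E,
      α (p b) (p c) (p e) - α (p (a * b)) (p c) (p e) + α (p a) (p (b * c)) (p e)
        - α (p a) (p b) (p (c * e)) + α (p a) (p b) (p c) =
      (η (a * b) - η a - η b) * (η (c * e) - η c - η e) := by
  rw [eulerClass, cup_class] at hcup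
  obtain ⟨w, hw⟩ := (cohomologyClass_eq_zero_iff ℚ G 3 _).1 hcup
  obtain ⟨ξ, hξ, hd⟩ := h.exists_coordinate
  have hf : ∀ g, η g = ξ g + η (h.sec (p g)) := fun g => by
    conv_lhs => rw [hξ g, hη]
  set f : G → ℝ := fun g => η (h.sec g)
  -- With $D=c-\delta f$ on `G`, one has $D\cup D=c\cup c-\delta f\cup D-c\cup\delta f$, which leads
  -- to $\alpha=w-f\cup D-c\cup f$.
  refine ⟨fun a b c => (w ![a, b, c] : ℝ)
    - f a * (h.defect b c + f (b * c) - f b - f c) - h.defect a b * f c, fun a b c e => ?_⟩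
  have hw' : (w ![p b, p c, p e] - w ![p a * p b, p c, p e] + w ![p a, p b * p c, p e]
      - w ![p a, p b, p c * p e] + w ![p a, p b, p c] : ℝ) =
      h.defect (p a) (p b) * h.defect (p c) (p e) := by
    have := congrFun hw ![p a, p b, p c, p e]
    rw [cobd_three] at this
    have h2 : cupCochain 2 2 (h.eulerCocycle ℚ).1 (h.eulerCocycle ℚ).1 ![p a, p b, p c, p e] =
      (h.defect (p a) (p b) * h.defect (p c) (p e) : ℚ) := cup_apply_two_two _ _ _ _ _ _
    exact_mod_cast congrArg (Rat.cast : ℚ → ℝ) (this.trans h2)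
  have hc1 := congrArg (Int.cast : ℤ → ℝ) (h.defect_cocycle (p a) (p b) (p c))
  have hc2 := congrArg (Int.cast : ℤ → ℝ) (h.defect_cocycle (p b) (p c) (p e))
  have hD : ∀ a b, η (a * b) - η a - η b =
      h.defect (p a) (p b) + f (p a * p b) - f (p a) - f (p b) := fun a b => by
    rw [hf, hf a, hf b, hd, map_mul]
    push_cast
    ring
  rw [hD, hD]
  simp only [map_mul, mul_assoc] at hw' hc1 hc2 ⊢
  push_cast at hc1 hc2
  linear_combination hw' + f (p a) * hc2 - f (p e) * hc1

end CentralExtension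

/-! ### How $\varphi_k$ acts on $T$ and on evaluation at $0$. -/

section AnalyticDiffLine

/-- This is the source of the period $T^k$ of $\alpha\circ\varphi_k$: the image of $T^k$ lies in the
kernel of `projection`, unlike that of $T$ itself. -/
lemma scaling_translation_pow (k : ℕ) (hk : 2 ≤ k) : scaling k hk (translation ^ k) = translation := by
  refine Subtype.ext (Equiv.ext fun x => ?_)
  have hk0 : (k : ℝ) ≠ 0 := by positivity
  refine (scaling_apply k hk _ x).trans ?_
  have h := translation_zpow_apply k (k * x)
  rw [zpow_natCast] at h
  rw [h]
  change _ = x + 1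
  push_cast
  field_simp

lemma projection_translation : projection translation = 1 :=
  (ker_projection _).2 ⟨1, (zpow_one _).symm⟩

/-- Evaluation at `0` of the lifts of circle diffeomorphisms. -/
noncomputable def evalZero (f : AnalyticDiffLine) : ℝ := f 0

lemma evalZero_translation_zpow_mul (i : ℤ) (f : AnalyticDiffLine) :
    evalZero (translation ^ i * f) = i + evalZero f :=
  (translation_zpow_apply i (f 0)).trans (add_comm _ _)

/-- The point $0$ is fixed by $x\mapsto kx$, which is what makes it the right base point for $\eta$.
-/
lemma evalZero_scaling (k : ℕ) (hk : 2 ≤ k) (f : AnalyticDiffLine) :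
    evalZero (scaling k hk f) = evalZero f / k := by
  refine (scaling_apply k hk f 0).trans ?_
  rw [mul_zero, one_div_mul_eq_div]
  rfl

end AnalyticDiffLine

end FlatCircle

/-! ### Comparison of the two evaluations. -/

open FlatCircle in
theorem proposition1p6
    (σ : FlatCircle.H ℤ FlatCircle.AnalyticDiffCircle 2)
    (hσ : FlatCircle.pairing 1 (FlatCircle.chi ℤ) σ ≠ 0)
    (k : ℕ) (hk : 2 ≤ k)
    (hφ : FlatCircle.homologyMap ℤ (FlatCircle.scaling k hk) 3 (FlatCircle.mu σ) =
      FlatCircle.mu σ) :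
    FlatCircle.cup (FlatCircle.chi ℚ) (FlatCircle.chi ℚ) ≠ 0 := by
  intro hcup
  have hext := isCentralExtension_projection
  obtain ⟨α, hα⟩ := hext.exists_primitive hcup evalZero evalZero_translation_zpow_mul
  obtain ⟨x, rfl⟩ := hext.baseCycle_surjective σ
  have hx := (mem_liftedChains translation x.1).1 x.2
  set α' : AnalyticDiffLine → AnalyticDiffLine → AnalyticDiffLine → ℝ := fun a b c =>
    α (projection a) (projection b) (projection c)
  have hclosed := cobd_transgression (η := evalZero) (α := α') hα
  -- Period $T$ itself ($m=1$), because $\alpha'$ is pulled back from $G$: the value of $\theta$ on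
  -- $[T]\times x$ is $-n$.
  have hid := evalReal_transgression translation_comm one_pos (η := evalZero) rfl
    (fun i g => by simpa using evalZero_translation_zpow_mul i g) (α := α')
    (by simp [α', projection_translation]) (by simp [α', projection_translation]) (by simp [α', projection_translation]) hα hx
  have hα' := fun a b c e => hα (scaling k hk a) (scaling k hk b) (scaling k hk c) (scaling k hk e)
  simp only [← map_mul (scaling k hk)] at hα'
  -- The same for $\varphi_k^*\theta$, with $\eta\circ\varphi_k$ growing by $1/k$ under $T$ and
  -- $\alpha'\circ\varphi_k$ of period $T^k$: the value is $-n/k^2$.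
  have hsc := evalReal_transgression translation_comm (m := k) (by omega)
    (η := fun f => evalZero (scaling k hk f)) (by simp [evalZero])
    (fun i g => by
      have := evalZero_translation_zpow_mul i g
      rw [zpow_natCast] at this
      rw [evalZero_scaling, evalZero_scaling, this]
      push_cast
      ring)
    (α := fun a b c => α' (scaling k hk a) (scaling k hk b) (scaling k hk c))
    (by simp only [scaling_translation_pow]; simp [α', projection_translation])
    (by simp only [scaling_translation_pow]; simp [α', projection_translation])
    (by simp only [scaling_translation_pow]; simp [α', projection_translation])
    hα' hx
  have hmu : mu ((homologyClass ℤ AnalyticDiffCircle 1 ∘ₗ hext.baseCycle) x) =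
      homologyClass ℤ AnalyticDiffLine 2 (hext.totalCycle x) := hext.gysin_apply x
  -- The invariance of $\mu(\sigma)$ now says that the cycle $[T]\times x$ and its image under
  -- $\varphi_k$ differ by a boundary, on which the closed $\theta$ vanishes.
  rw [hmu, homologyMap_homologyClass, ← sub_eq_zero, ← map_sub,
    homologyClass_eq_zero_iff] at hφ
  obtain ⟨w, hw⟩ := hφ
  have he := congrArg (evalReal (transgression evalZero α')) hw
  rw [evalReal_bd, hclosed, Submodule.coe_sub, map_sub, evalReal_push, hext.totalCycle_coe] at he
  have hpull : (fun g : Fin 3 → AnalyticDiffLine =>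
      transgression evalZero α' fun i => scaling k hk (g i)) =
      transgression (fun f => evalZero (scaling k hk f))
        (fun a b c => α' (scaling k hk a) (scaling k hk b) (scaling k hk c)) := by
    funext g
    simp only [transgression, map_mul]
  have h0 : evalReal (0 : Cochain ℝ AnalyticDiffLine 4) w = 0 := by simp [evalReal]
  rw [hpull, h0, eq_comm, sub_eq_zero] at he
  rw [he] at hsc
  -- Equating the two values gives $n=n/k^2$, and $k\ge2$ forces $n=0$.
  have hn : (x.1.2 : ℝ) * ((k : ℝ) ^ 2 - 1) = 0 := by
    push_cast at hid
    linear_combination (k : ℝ) ^ 2 * hid - hsc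
  have hk2 : (2 : ℝ) ≤ k := by exact_mod_cast hk
  have hk3 : (k : ℝ) ^ 2 - 1 ≠ 0 := by nlinarith
  exact hσ (hext.pairing_eq_zero x (by exact_mod_cast (mul_eq_zero.1 hn).resolve_right hk3))
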